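/- **Setting.** Consider $\min f(x)$ subject to $c(x)=0$, $x\ge 0$, with $f:\mathbb R^n\to\mathbb R$ and $c:\mathbb R^n\to\mathbb R^m$ twice continuously differentiable, $g=\nabla f$, $J$ the Jacobian of $c$, and $H(x,y)=\nabla^2_{xx}\big(f(x)-c(x)^Ty\big)$. All norms are Euclidean. For fixed $\nu>0$ and $v=(x,y)$ let $$\mathcal M^\nu(v;y^E,\mu)=f(x)-c(x)^Ty^E+\tfrac1{2\mu}\|c(x)\|^2+\tfrac{\nu}{2\mu}\|c(x)+\mu(y-y^E)\|^2 .$$ Let $u_{\max},\epsilon_a,\kappa,y_{\max}>0$ and $\eta_S,\alpha_{\min}\in(0,1)$ be fixed parameters. Starting from $v_0=(x_0,y_0)$, $y^E_0$, $\tau_0>0$, $\mu_0>0$, $\phi_S^{\max}$, $\phi_L^{\max}$, and with regularization parameters $\mu^R_k>0$, the regularized SQP method with directions of negative curvature generates iterates $v_k=(x_k,y_k)$ with $x_k\ge0$ as follows (write $J_k=J(x_k)$, $H_k=H(x_k,y_k)$). 1. *Curvature direction.* Let $F_k=\{i:[x_k]_i>\min(\mu_k,\epsilon_a)\}$. Factorize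 the KKT matrix $\begin{pmatrix}H_F&J_F^T\\J_F&-\mu^R_kI\end{pmatrix}$ of the variables in $F=F_k$ symmetrically as $LBL^T$, using, in any order, only pivots that are positive diagonal entries of the $H$ part, negative diagonal entries of the $D$ (lower right) part, or $2\times2$ blocks with one index in each part and negative determinant, until no such pivot is left. Let $S$ be the remaining Schur complement, $\begin{pmatrix}L_1&0\\L_2&I\end{pmatrix}$ the triangular factor, and $\rho=\max_{i,j}|S_{ij}|=|S_{qr}|$. Solve $\begin{pmatrix}L_1&0\\L_2&I\end{pmatrix}^Tz=\sqrt\rho\,h$, where $h=e_q$ if $q=r$ and $h=\frac1{\sqrt2}(e_q-\operatorname{sgn}(S_{qr})e_r)$ otherwise ($z=0$ if $S$ is empty). Then $\hat u_k$ is, up to sign, the vector that equals the primal part of $z$ on $F_k$ and $0$ elsewhere; with $\hat w_k=-\frac1{\mu^R_k}J_k\hat u_k$ the sign is such that $\nabla\mathcal M^\nu(v_k;y^E_k,\mu^R_k)^T(\hat u_k,\hat w_k)\le0$. Put $\theta_k=\hat u_k^T(H_k+\frac1{\mu^R_k}J_k^TJ_k)\hat u_k/\|\hat u_k\|^2$,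 with $\theta_k=0$ if $\hat u_k=0$. 2. *QP step.* $\Delta v_k=(p_k,q_k)$ minimizes $\nabla\mathcal M^\nu(v_k;y^E_k,\mu^R_k)^Td+\frac12d^TH_M^\nu d$ over $d=(p,q)$ with $x_k+p\ge0$, where $H_M^\nu=\begin{pmatrix}\bar H_k+\frac{1+\nu}{\mu^R_k}J_k^TJ_k&\nu J_k^T\\\nu J_k&\nu\mu^R_kI\end{pmatrix}$. 3. *Scaling.* $(u_k,w_k)=\beta(\hat u_k,\hat w_k)$, with $\beta$ the largest number such that $x_k+p_k+\beta\hat u_k\ge0$ and $\|\beta\hat u_k\|\le\max(u_{\max},2\|p_k\|)$; $(u_k,w_k)=0$ if $\hat u_k=0$. 4. *Line search.* $v_{k+1}=v_k+\alpha_k(u_k,w_k)+\alpha_k^2\Delta v_k$, where $\alpha_k=2^{-j}$ for some integer $j\ge0$ and, for some $\mu^F_k\in[\mu^R_k,\mu_k]$, $\mathcal M^\nu(v_{k+1};y^E_k,\mu^F_k)\le\mathcal M^\nu(v_k;y^E_k,\mu^F_k)+\alpha_k^2\eta_SN_k+\alpha_k\eta_SR_k$. Here $R_k=(u_k,w_k)^T\nabla^2\mathcal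 M^\nu(v_k;y^E_k,\mu^R_k)(u_k,w_k)$ and $N_k=\max\big(\nabla\mathcal M^\nu(v_k;y^E_k,\mu^R_k)^T\Delta v_k,-\kappa\|\Delta v_k\|^2\big)$. 5. *Penalty parameter.* With $\bar\alpha=\min(\alpha_{\min},\alpha_k)$: $\mu_{k+1}=\mu_k$ if $\mathcal M^\nu(v_{k+1};y^E_k,\mu_k)\le\mathcal M^\nu(v_k;y^E_k,\mu_k)+\bar\alpha\eta_SR_k+\bar\alpha^2\eta_SN_k$, and $\mu_{k+1}=\max(\frac12\mu_k,\mu^R_{k+1})$ otherwise. 6. *Type of $v_{k+1}$.* Let $\omega_k$ be the minimum, or (as another choice of the method, fixed for all $k$) the maximum, of $\|\min(x_k,g(x_k)-J_k^Ty_k)\|$ and $-\theta_k$. Then $v_{k+1}$ is an S-iterate if $\|c(x_{k+1})\|+10^{-5}\omega_{k+1}\le\frac12\phi_S^{\max}$; otherwise an L-iterate if $10^{-5}\|c(x_{k+1})\|+\omega_{k+1}\le\frac12\phi_L^{\max}$; otherwise an M-iterate if $\|\nabla_y\mathcal M^\nu(v_{k+1};y^E_k,\mu^R_k)\|\le\tau_k$,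 $\|\min(x_{k+1},\nabla_x\mathcal M^\nu(v_{k+1};y^E_k,\mu^R_k))\|\le\tau_k$ and $\theta_{k+1}\ge-\tau_k$; otherwise an F-iterate. (The starting point $v_0$ is not tested and counts as an F-iterate.) After an S- or L-iterate $y^E_{k+1}=y_{k+1}$, $\tau_{k+1}=\tau_k$ and $\phi_S^{\max}$, respectively $\phi_L^{\max}$, is halved; after an M-iterate $y^E_{k+1}=\max(-y_{\max},\min(y_{k+1},y_{\max}))$ componentwise and $\tau_{k+1}=\frac12\tau_k$; after an F-iterate $y^E_{k+1}=y^E_k$, $\tau_{k+1}=\tau_k$. Nothing else changes. Assume that the symmetric matrices $\bar H_k$ are bounded, that $\bar H_k+\frac1{\mu^R_k}J_k^TJ_k$ is uniformly positive definite, and that $\{x_k\}$ is contained in a compact set. **Theorem.** If there is an integer $\widehat k\ge 0$ such that $\mu^R_k=\mu^R>0$ and $v_k$ is an F-iterate for all $k\ge\widehat k$, then 1. $\{\|\Delta v_k\|+\|u_k\|\}_{k\ge\widehat k}$ is bounded away from zero; 2. there is an $\epsilon>0$ such that for every $k\ge\widehat k$, $$\nabla\mathcal M^\nu(v_k;y^E_k,\mu^R_k)^T\Delta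 v_k\le-\epsilon\quad\text{or}\quad (u_k,w_k)^T\nabla^2\mathcal M^\nu(v_k;y^E_k,\mu^R_k)(u_k,w_k)\le-\epsilon .$$ -/

import Mathlib

namespace PDSQP

open Matrix

noncomputable section

/-- `ℝⁿ` with the Euclidean norm. -/
abbrev Vec (n : ℕ) := EuclideanSpace ℝ (Fin n)

/-! ### Inertia-controlling factorization and the direction of negative curvature -/

section Factorization

variable {α β : Type} [Fintype α] [DecidableEq α] [Fintype β] [DecidableEq β]

/-- The pivots allowed in the first stage. `R` is the set of indices not yet eliminated and the
`R × R` part of `M` is the current Schur complement; indices `inl a` belong to the `H` block of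
the KKT matrix, indices `inr b` to its `D` block. The admissible pivots are a positive diagonal
entry of the `H` part (`H⁺`), a negative diagonal entry of the `D` part (`D⁻`), and a `2 × 2`
block with one index in each part and eigenvalues of mixed sign, i.e. with negative
determinant (`HD`). -/
def IsPivot (R : Finset (α ⊕ β)) (M : Matrix (α ⊕ β) (α ⊕ β) ℝ) (Q : Finset (α ⊕ β)) : Prop :=
  (∃ a : α, Sum.inl a ∈ R ∧ Q = {Sum.inl a} ∧ 0 < M (Sum.inl a) (Sum.inl a)) ∨
  (∃ b : β, Sum.inr b ∈ R ∧ Q = {Sum.inr b} ∧ M (Sum.inr b) (Sum.inr b) < 0) ∨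
  (∃ (a : α) (b : β), Sum.inl a ∈ R ∧ Sum.inr b ∈ R ∧ Q = {Sum.inl a, Sum.inr b} ∧
    M (Sum.inl a) (Sum.inl a) * M (Sum.inr b) (Sum.inr b)
      - M (Sum.inl a) (Sum.inr b) * M (Sum.inr b) (Sum.inl a) < 0)

/-- The block `M_{R∖Q,Q} (M_{Q,Q})⁻¹` of multipliers of a pivot `Q`, extended by zero. -/
def multipliers {ι : Type} [Fintype ι] [DecidableEq ι] (R Q : Finset ι) (M : Matrix ι ι ℝ) :
    Matrix ι ι ℝ :=
  Matrix.of fun a b =>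
    if h : a ∈ R \ Q ∧ b ∈ Q then
      ∑ e : {i // i ∈ Q}, M a e.1 *
        (M.submatrix (fun i : {i // i ∈ Q} => i.1) (fun i : {i // i ∈ Q} => i.1))⁻¹ e ⟨b, h.2⟩
    else 0

/-- `PartialLBL K R L M`: admissible pivots on `K` lead to the partial factorization
`K = L M Lᵀ`, where `M` is block diagonal, with the pivot blocks (the matrix `B`) on the
eliminated indices and the Schur complement on the set `R` of remaining indices. In the order of
elimination `L` is the unit lower triangular matrix `[L₁ 0; L₂ I]`. -/
inductive PartialLBL (K : Matrix (α ⊕ β) (α ⊕ β) ℝ) :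
    Finset (α ⊕ β) → Matrix (α ⊕ β) (α ⊕ β) ℝ → Matrix (α ⊕ β) (α ⊕ β) ℝ → Prop
  | start : PartialLBL K Finset.univ 1 K
  | pivot (R : Finset (α ⊕ β)) (L M : Matrix (α ⊕ β) (α ⊕ β) ℝ) (Q : Finset (α ⊕ β)) :
      PartialLBL K R L M → IsPivot R M Q →
      PartialLBL K (R \ Q) (L * (1 + multipliers R Q M))
        ((1 - multipliers R Q M) * M * (1 - multipliers R Q M)ᵀ)

/-- The vector `h`: `e_q` if `q = r`, and `(e_q - sgn(S_qr) e_r) / √2` otherwise. -/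
def hVec {ι : Type} [DecidableEq ι] (S : Matrix ι ι ℝ) (q r : ι) : ι → ℝ :=
  if q = r then Pi.single q 1
  else (1 / √2) • (Pi.single q 1 - Real.sign (S q r) • Pi.single r (1 : ℝ))

/-- `z` is a result of the curvature computation for `K`: the first stage of the factorization is
carried out until no admissible pivot is left; with `S` the Schur complement and
`ρ = |S_qr| = max |S_ij|`, the vector `z` solves `[L₁ 0; L₂ I]ᵀ z = √ρ h`. If nothing is left to
factorize, there is no negative curvature and `z = 0` (and `z = 0` too when `S = 0`). -/
def IsCurvatureVector (K : Matrix (α ⊕ β) (α ⊕ β) ℝ) (z : α ⊕ β → ℝ) : Prop :=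
  ∃ (R : Finset (α ⊕ β)) (L S : Matrix (α ⊕ β) (α ⊕ β) ℝ),
    PartialLBL K R L S ∧ (∀ Q, ¬ IsPivot R S Q) ∧
    ((R = ∅ ∧ z = 0) ∨
      ∃ q ∈ R, ∃ r ∈ R, (∀ i ∈ R, ∀ j ∈ R, |S i j| ≤ |S q r|) ∧
        Lᵀ *ᵥ z = √|S q r| • hVec S q r)

end Factorization

/-! ### The problem and the merit function -/

/-- The problem: minimize `f x` subject to `c x = 0`, `x ≥ 0`. -/
structure NLP (n m : ℕ) where
  f : Vec n → ℝ
  c : Vec n → Vec m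

namespace NLP

variable {n m : ℕ} (P : NLP n m)

/-- The Jacobian matrix `J(x)` of `c`. -/
def jac (x : Vec n) : Matrix (Fin m) (Fin n) ℝ :=
  Matrix.of fun i j => fderiv ℝ P.c x (EuclideanSpace.single j 1) i

/-- The Hessian `H(x, y)` in `x` of the Lagrangian `f(x) - c(x)ᵀ y`. -/
def lagHess (x : Vec n) (y : Vec m) : Matrix (Fin n) (Fin n) ℝ :=
  Matrix.of fun i j =>
    fderiv ℝ (fderiv ℝ (fun t : Vec n => P.f t - inner ℝ (P.c t) y)) x
      (EuclideanSpace.single i 1) (EuclideanSpace.single j 1)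

/-- The primal-dual augmented Lagrangian `M^ν(v; y^E, μ)` at `v = (x, y)`. -/
def merit (ν : ℝ) (yE : Vec m) (μ : ℝ) (v : Vec n × Vec m) : ℝ :=
  P.f v.1 - inner ℝ (P.c v.1) yE + 1 / (2 * μ) * ‖P.c v.1‖ ^ 2
    + ν / (2 * μ) * ‖P.c v.1 + μ • (v.2 - yE)‖ ^ 2

/-- `∇M^ν(v; y^E, μ)ᵀ d`. -/
def meritSlope (ν : ℝ) (yE : Vec m) (μ : ℝ) (v d : Vec n × Vec m) : ℝ :=
  fderiv ℝ (P.merit ν yE μ) v d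

/-- `dᵀ ∇²M^ν(v; y^E, μ) d`. -/
def meritCurv (ν : ℝ) (yE : Vec m) (μ : ℝ) (v d : Vec n × Vec m) : ℝ :=
  fderiv ℝ (fderiv ℝ (P.merit ν yE μ)) v d d

/-- `∇_x M^ν(x, y; y^E, μ)`. -/
def meritGradX (ν : ℝ) (yE : Vec m) (μ : ℝ) (x : Vec n) (y : Vec m) : Vec n :=
  gradient (fun t => P.merit ν yE μ (t, y)) x

/-- `∇_y M^ν(x, y; y^E, μ)`. -/
def meritGradY (ν : ℝ) (yE : Vec m) (μ : ℝ) (x : Vec n) (y : Vec m) : Vec m :=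
  gradient (fun t => P.merit ν yE μ (x, t)) y

/-- `H_M^ν = [H̄ + (1/μ)(1+ν) JᵀJ, ν Jᵀ; ν J, ν μ I]`, the QP Hessian, where `B` stands
for `H̄`. -/
def qpHess (ν μ : ℝ) (x : Vec n) (B : Matrix (Fin n) (Fin n) ℝ) :
    Matrix (Fin n ⊕ Fin m) (Fin n ⊕ Fin m) ℝ :=
  Matrix.fromBlocks (B + ((1 + ν) / μ) • ((P.jac x)ᵀ * P.jac x)) (ν • (P.jac x)ᵀ)
    (ν • P.jac x) ((ν * μ) • (1 : Matrix (Fin m) (Fin m) ℝ))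

/-- The objective `∇Mᵀ d + ½ dᵀ H_M^ν d` of the QP subproblem. -/
def qpObj (ν : ℝ) (yE : Vec m) (μ : ℝ) (B : Matrix (Fin n) (Fin n) ℝ) (v d : Vec n × Vec m) : ℝ :=
  P.meritSlope ν yE μ v d
    + 1 / 2 * (Sum.elim d.1.ofLp d.2.ofLp ⬝ᵥ
        (P.qpHess ν μ v.1 B *ᵥ Sum.elim d.1.ofLp d.2.ofLp))

/-- The KKT matrix `[H_F, J_Fᵀ; J_F, -μ I]` of the variables in `F`. -/
def kkt (μ : ℝ) (x : Vec n) (y : Vec m) (F : Finset (Fin n)) :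
    Matrix ({i // i ∈ F} ⊕ Fin m) ({i // i ∈ F} ⊕ Fin m) ℝ :=
  Matrix.fromBlocks ((P.lagHess x y).submatrix (fun i => i.1) (fun i => i.1))
    ((P.jac x).submatrix id (fun i => i.1))ᵀ
    ((P.jac x).submatrix id (fun i => i.1)) (-(μ • (1 : Matrix (Fin m) (Fin m) ℝ)))

end NLP

/-- The Euclidean norm of a primal-dual vector `(p, q)`. -/
def pairNorm {n m : ℕ} (p : Vec n) (q : Vec m) : ℝ := √(‖p‖ ^ 2 + ‖q‖ ^ 2)

/-- The componentwise minimum of two vectors. -/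
def vmin {n : ℕ} (a b : Vec n) : Vec n := WithLp.toLp 2 fun i => min (a i) (b i)

/-- The vector of `ℝⁿ` with `F`-part the primal part of `z`, and zero outside `F`. -/
def extendFree {n m : ℕ} (F : Finset (Fin n)) (z : {i // i ∈ F} ⊕ Fin m → ℝ) : Vec n :=
  WithLp.toLp 2 fun i => if h : i ∈ F then z (Sum.inl ⟨i, h⟩) else 0

/-! ### The algorithm -/

/-- The fixed parameters of the method. `agg` is the rule that combines the first-order and the
curvature part of the optimality measure `ω`; it may be the minimum or the maximum. -/
structure Params where
  ν : ℝ
  uMax : ℝ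
  epsA : ℝ
  etaS : ℝ
  alphaMin : ℝ
  kappa : ℝ
  yMax : ℝ
  agg : ℝ → ℝ → ℝ
  ν_pos : 0 < ν
  uMax_pos : 0 < uMax
  epsA_pos : 0 < epsA
  etaS_pos : 0 < etaS
  etaS_lt : etaS < 1
  alphaMin_pos : 0 < alphaMin
  alphaMin_lt : alphaMin < 1
  kappa_pos : 0 < kappa
  yMax_pos : 0 < yMax
  agg_eq : agg = min ∨ agg = max

/-- The quantities generated by the method: iterates `(x, y)`, multiplier estimates `yE`,
regularization parameters `μR`, penalty parameters `μ`, tolerances `τ`, filter bounds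
`φ_S^max`, `φ_L^max`, the matrices `H̄`, the QP solutions `Δv = (p, q)`, the unscaled and scaled
curvature directions `û`, `u`, `w`, and the step lengths. -/
structure Iterates (n m : ℕ) where
  x : ℕ → Vec n
  y : ℕ → Vec m
  yE : ℕ → Vec m
  μR : ℕ → ℝ
  μ : ℕ → ℝ
  τ : ℕ → ℝ
  phiSMax : ℕ → ℝ
  phiLMax : ℕ → ℝ
  Hbar : ℕ → Matrix (Fin n) (Fin n) ℝ
  p : ℕ → Vec n
  q : ℕ → Vec m
  uhat : ℕ → Vec n
  u : ℕ → Vec n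
  w : ℕ → Vec m
  step : ℕ → ℝ

namespace Iterates

variable {n m : ℕ} (s : Iterates n m) (P : NLP n m) (a : Params)

/-- `v_k = (x_k, y_k)`. -/
def v (k : ℕ) : Vec n × Vec m := (s.x k, s.y k)

/-- The free variables: those not in `W_k = {i | [x_k]_i ≤ min(μ_k, ε_a)}`. -/
def free (k : ℕ) : Finset (Fin n) :=
  Finset.univ.filter fun i => min (s.μ k) a.epsA < s.x k i

/-- `ŵ_k = -(1/μ) J û_k`. -/
def what (k : ℕ) : Vec m :=
  WithLp.toLp 2 (-(1 / s.μR k) • (P.jac (s.x k) *ᵥ (s.uhat k).ofLp))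

/-- `û_kᵀ (H + (1/μ) JᵀJ) û_k / ‖û_k‖²` at `v_k`, read as `0` when `û_k = 0`. -/
def curvRatio (k : ℕ) : ℝ :=
  ((s.uhat k).ofLp ⬝ᵥ ((P.lagHess (s.x k) (s.y k)
      + (1 / s.μR k) • ((P.jac (s.x k))ᵀ * P.jac (s.x k))) *ᵥ (s.uhat k).ofLp))
    / ‖s.uhat k‖ ^ 2

/-- `∇M^ν(v_k; y^E_k, μ^R_k)ᵀ Δv_k`. -/
def slope (k : ℕ) : ℝ :=
  P.meritSlope a.ν (s.yE k) (s.μR k) (s.v k) (s.p k, s.q k)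

/-- `R_k`, the curvature of `M^ν(·; y^E_k, μ^R_k)` at `v_k` along the step `(u_k, w_k)`. -/
def curv (k : ℕ) : ℝ :=
  P.meritCurv a.ν (s.yE k) (s.μR k) (s.v k) (s.u k, s.w k)

/-- `N_k = max(∇Mᵀ Δv_k, -κ ‖Δv_k‖²)`. -/
def Nk (k : ℕ) : ℝ :=
  max (s.slope P a k) (-a.kappa * pairNorm (s.p k) (s.q k) ^ 2)

/-- `ω` at `v_k`. -/
def omega (k : ℕ) : ℝ :=
  a.agg ‖vmin (s.x k) (gradient P.f (s.x k) -
      WithLp.toLp 2 ((P.jac (s.x k))ᵀ *ᵥ (s.y k).ofLp))‖ (-(s.curvRatio P k))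

/-- `φ_S` at `v_k`. -/
def phiS (k : ℕ) : ℝ := ‖P.c (s.x k)‖ + (10 : ℝ)⁻¹ ^ 5 * s.omega P a k

/-- `φ_L` at `v_k`. -/
def phiL (k : ℕ) : ℝ := (10 : ℝ)⁻¹ ^ 5 * ‖P.c (s.x k)‖ + s.omega P a k

/-- The test that makes `v_{k+1}` an S-iterate. -/
def STest (k : ℕ) : Prop := s.phiS P a (k + 1) ≤ 1 / 2 * s.phiSMax k

/-- The test that makes `v_{k+1}` an L-iterate (if it is not an S-iterate). -/
def LTest (k : ℕ) : Prop := s.phiL P a (k + 1) ≤ 1 / 2 * s.phiLMax k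

/-- The test that makes `v_{k+1}` an M-iterate (if it is neither an S- nor an L-iterate). -/
def MTest (k : ℕ) : Prop :=
  ‖P.meritGradY a.ν (s.yE k) (s.μR k) (s.x (k + 1)) (s.y (k + 1))‖ ≤ s.τ k ∧
  ‖vmin (s.x (k + 1))
    (P.meritGradX a.ν (s.yE k) (s.μR k) (s.x (k + 1)) (s.y (k + 1)))‖ ≤ s.τ k ∧
  -(s.τ k) ≤ s.curvRatio P (k + 1)

/-- `v_k` is an F-iterate: it passed none of the tests. The starting point `v_0` is not
tested, and the condition is void for it. -/
def IsFIterate (k : ℕ) : Prop :=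
  ∀ j, k = j + 1 → ¬ s.STest P a j ∧ ¬ s.LTest P a j ∧ ¬ s.MTest P a j

/-- `s` is generated by the method for the problem `P`. -/
structure IsRun : Prop where
  τ_pos : 0 < s.τ 0
  μ_pos : 0 < s.μ 0
  /-- The regularization parameters are positive; nothing else is asked of their update. -/
  μR_pos : ∀ k, 0 < s.μR k
  /-- The iterates satisfy the bounds. -/
  x_nonneg : ∀ k i, 0 ≤ s.x k i
  /-- `û_k` comes from the factorization of the KKT matrix of the free variables, up to sign. -/
  uhat_eq : ∀ k, ∃ z,
    IsCurvatureVector (P.kkt (s.μR k) (s.x k) (s.y k) (s.free a k)) z ∧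
    (s.uhat k = extendFree (s.free a k) z ∨ s.uhat k = -extendFree (s.free a k) z)
  /-- The sign is chosen so that `(û, ŵ)` is not an ascent direction. -/
  uhat_descent : ∀ k,
    P.meritSlope a.ν (s.yE k) (s.μR k) (s.v k) (s.uhat k, s.what P k) ≤ 0
  /-- `Δv_k = (p_k, q_k)` solves the convex QP. -/
  qp_feasible : ∀ k i, 0 ≤ s.x k i + s.p k i
  qp_min : ∀ k, ∀ d : Vec n × Vec m, (∀ i, 0 ≤ s.x k i + d.1 i) →
    P.qpObj a.ν (s.yE k) (s.μR k) (s.Hbar k) (s.v k) (s.p k, s.q k)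
      ≤ P.qpObj a.ν (s.yE k) (s.μR k) (s.Hbar k) (s.v k) d
  /-- The curvature direction is scaled as far as the bounds and `max(u_max, 2‖p‖)` allow. -/
  scaling : ∀ k, (s.uhat k = 0 ∧ s.u k = 0 ∧ s.w k = 0) ∨
    (s.uhat k ≠ 0 ∧ ∃ b : ℝ,
      IsGreatest {t : ℝ | (∀ i, 0 ≤ s.x k i + s.p k i + t * s.uhat k i) ∧
        ‖t • s.uhat k‖ ≤ max a.uMax (2 * ‖s.p k‖)} b ∧
      s.u k = b • s.uhat k ∧ s.w k = b • s.what P k)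
  /-- The step length is a power of one half that passes the flexible line search. -/
  step_pow : ∀ k, ∃ j : ℕ, s.step k = (1 / 2 : ℝ) ^ j
  x_succ : ∀ k, s.x (k + 1) = s.x k + s.step k • s.u k + s.step k ^ 2 • s.p k
  y_succ : ∀ k, s.y (k + 1) = s.y k + s.step k • s.w k + s.step k ^ 2 • s.q k
  line_search : ∀ k, ∃ μF : ℝ, s.μR k ≤ μF ∧ μF ≤ s.μ k ∧
    P.merit a.ν (s.yE k) μF (s.v (k + 1)) ≤ P.merit a.ν (s.yE k) μF (s.v k)
      + s.step k ^ 2 * a.etaS * s.Nk P a k + s.step k * a.etaS * s.curv P a k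
  /-- The update of the penalty parameter. -/
  μ_keep : ∀ k, P.merit a.ν (s.yE k) (s.μ k) (s.v (k + 1))
        ≤ P.merit a.ν (s.yE k) (s.μ k) (s.v k)
          + min a.alphaMin (s.step k) * a.etaS * s.curv P a k
          + min a.alphaMin (s.step k) ^ 2 * a.etaS * s.Nk P a k →
      s.μ (k + 1) = s.μ k
  μ_reduce : ∀ k, ¬ P.merit a.ν (s.yE k) (s.μ k) (s.v (k + 1))
        ≤ P.merit a.ν (s.yE k) (s.μ k) (s.v k)
          + min a.alphaMin (s.step k) * a.etaS * s.curv P a k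
          + min a.alphaMin (s.step k) ^ 2 * a.etaS * s.Nk P a k →
      s.μ (k + 1) = max (1 / 2 * s.μ k) (s.μR (k + 1))
  /-- The updates after an S-iterate, an L-iterate, an M-iterate and an F-iterate. -/
  S_update : ∀ k, s.STest P a k →
    s.phiSMax (k + 1) = 1 / 2 * s.phiSMax k ∧ s.phiLMax (k + 1) = s.phiLMax k ∧
    s.yE (k + 1) = s.y (k + 1) ∧ s.τ (k + 1) = s.τ k
  L_update : ∀ k, ¬ s.STest P a k → s.LTest P a k →
    s.phiSMax (k + 1) = s.phiSMax k ∧ s.phiLMax (k + 1) = 1 / 2 * s.phiLMax k ∧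
    s.yE (k + 1) = s.y (k + 1) ∧ s.τ (k + 1) = s.τ k
  M_update : ∀ k, ¬ s.STest P a k → ¬ s.LTest P a k → s.MTest P a k →
    s.phiSMax (k + 1) = s.phiSMax k ∧ s.phiLMax (k + 1) = s.phiLMax k ∧
    (∀ i, s.yE (k + 1) i = max (-a.yMax) (min (s.y (k + 1) i) a.yMax)) ∧
    s.τ (k + 1) = 1 / 2 * s.τ k
  F_update : ∀ k, ¬ s.STest P a k → ¬ s.LTest P a k → ¬ s.MTest P a k →
    s.phiSMax (k + 1) = s.phiSMax k ∧ s.phiLMax (k + 1) = s.phiLMax k ∧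
    s.yE (k + 1) = s.yE k ∧ s.τ (k + 1) = s.τ k

/-- The matrices `H̄_k` are symmetric and bounded, and `H̄_k + (1/μ^R_k) J(x_k)ᵀ J(x_k)` is
uniformly positive definite. -/
def HbarAssumption : Prop :=
  (∀ k, (s.Hbar k).IsSymm) ∧
  (∃ C : ℝ, ∀ k i j, |s.Hbar k i j| ≤ C) ∧
  ∃ l : ℝ, 0 < l ∧ ∀ k, ∀ d : Vec n,
    l * ‖d‖ ^ 2 ≤ d.ofLp ⬝ᵥ
      ((s.Hbar k + (1 / s.μR k) • ((P.jac (s.x k))ᵀ * P.jac (s.x k))) *ᵥ d.ofLp)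

end Iterates

end

end PDSQP

/-! From `khat` on, `yE`, `τ` and `μR` are frozen. Let `k > khat`. If the QP step is not small,
positive definiteness of the QP Hessian makes the slope negative by a fixed amount. If it is small,
the first-order residuals of the merit function, which are at most a multiple of the QP step, lie
below `τ`. The iterate nevertheless failed the M-test, so its curvature ratio is below `-τ`. Then
the curvature direction is nonzero, and it can be scaled to a fixed length because it moves only
variables larger than `min μR ε_a`. The curvature of the merit function along it differs from that
of `H + (1/μ) JᵀJ` by a multiple of the QP step, hence it is at most a negative constant. The
estimates are collected in `exists_uniform_bounds`, the length of the direction is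
`IsRun.le_norm_u`.

The index `khat` itself is different: `v_khat` may be the untested starting point, or may have been
tested with another regularization parameter. For one index it suffices that the quantities are
nonzero. If the QP step and the curvature direction both vanished, the next iterate would be the
same point with the same free variables (`IsRun.succ_eq_of_null_step`). It fails the M-test with
zero residuals, so its factorization must find negative curvature although the previous one found
none. The two factorizations may choose different pivots, so a contradiction needs the fact that any
factorization returning no direction certifies semidefiniteness on the free variables
(`IsCurvatureVector.form_nonneg`). If only the QP step vanishes, a nonzero direction has strictly
negative curvature (`IsCurvatureVector.form_neg`).

Both facts come from `PartialLBL.exists_form_ge`, a variational substitute for counting inertia: by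
adjusting eliminated dual entries, the form of the KKT matrix can be made to dominate that of the
Schur complement, while completing the square shows that it never exceeds the form of `H + (1/μ)
JᵀJ`. -/

namespace PDSQP

open Matrix

/-! ### Block elimination of one pivot. -/

section Multipliers

variable {ι : Type} [Fintype ι] [DecidableEq ι] {R Q : Finset ι} {M : Matrix ι ι ℝ}

lemma multipliers_eq_zero_left {i : ι} (h : i ∉ R \ Q) (j : ι) : multipliers R Q M i j = 0 := by
  simp only [multipliers, of_apply]
  exact dif_neg fun h' => h h'.1

lemma multipliers_eq_zero_right (i : ι) {j : ι} (h : j ∉ Q) : multipliers R Q M i j = 0 := by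
  simp only [multipliers, of_apply]
  exact dif_neg fun h' => h h'.2

/-- The rows lie in `R \ Q` and the columns in `Q`, which are disjoint. Hence `1 + N` and `1 - N`
are mutually inverse. -/
lemma multipliers_mul_self : multipliers R Q M * multipliers R Q M = 0 := by
  ext i j
  rw [mul_apply]
  refine Finset.sum_eq_zero fun e _ => ?_
  by_cases he : e ∈ Q
  · rw [multipliers_eq_zero_left (i := e) (by simp [he]), mul_zero]
  · rw [multipliers_eq_zero_right i he, zero_mul]

lemma multipliers_mul_apply
    (hdet : (M.submatrix (fun i : {i // i ∈ Q} => i.1) (fun i : {i // i ∈ Q} => i.1)).det ≠ 0)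
    {i j : ι} (hi : i ∈ R \ Q) (hj : j ∈ Q) : (multipliers R Q M * M) i j = M i j := by
  set A := M.submatrix (fun i : {i // i ∈ Q} => i.1) (fun i : {i // i ∈ Q} => i.1) with hA
  have h1 : (multipliers R Q M * M) i j = ∑ e : {i // i ∈ Q}, multipliers R Q M i e * M e j := by
    rw [mul_apply, Finset.sum_coe_sort Q (fun e => multipliers R Q M i e * M e j)]
    symm
    refine Finset.sum_subset (Finset.subset_univ _) fun e _ he => ?_
    rw [multipliers_eq_zero_right i he, zero_mul]
  have h2 : ∀ e : {i // i ∈ Q}, multipliers R Q M i e = ∑ f : {i // i ∈ Q}, M i f * A⁻¹ f e := by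
    intro e
    simp only [multipliers, of_apply]
    rw [dif_pos ⟨hi, e.2⟩]
  have h3 : A⁻¹ * A = 1 := nonsing_inv_mul _ (isUnit_iff_ne_zero.2 hdet)
  rw [h1]
  simp only [h2, Finset.sum_mul]
  rw [Finset.sum_comm]
  have h4 : ∀ f : {i // i ∈ Q}, ∑ e : {i // i ∈ Q}, M i f * A⁻¹ f e * M e j
      = M i f * (1 : Matrix {i // i ∈ Q} {i // i ∈ Q} ℝ) f ⟨j, hj⟩ := by
    intro f
    rw [← h3, mul_apply, Finset.mul_sum]
    refine Finset.sum_congr rfl fun e _ => ?_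
    rw [mul_assoc]
    rfl
  rw [Finset.sum_congr rfl fun f _ => h4 f, Finset.sum_eq_single (⟨j, hj⟩ : {i // i ∈ Q})]
  · simp
  · intro f _ hf
    simp [one_apply_ne hf]
  · simp

/-- The Schur complement is decoupled from the pivot. -/
lemma schur_apply_eq_zero
    (hdet : (M.submatrix (fun i : {i // i ∈ Q} => i.1) (fun i : {i // i ∈ Q} => i.1)).det ≠ 0)
    (hM : ∀ i ∈ R, ∀ j ∉ R, M i j = 0) (hQ : Q ⊆ R)
    {i j : ι} (hi : i ∈ R \ Q) (hj : j ∉ R \ Q) :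
    ((1 - multipliers R Q M) * M * (1 - multipliers R Q M)ᵀ : Matrix ι ι ℝ) i j = 0 := by
  -- The left factor already clears the rows in `R \ Q`: on `Q` by the choice of multipliers, and
  -- outside `R` because the rows of `M` in `R` vanish there. The right factor does not alter the
  -- columns outside `R \ Q`.
  have hX : ∀ e ∉ R \ Q, ((1 - multipliers R Q M) * M : Matrix ι ι ℝ) i e = 0 := by
    intro e he
    rw [sub_mul, one_mul, Matrix.sub_apply]
    by_cases heQ : e ∈ Q
    · rw [multipliers_mul_apply hdet hi heQ, sub_self]
    · have heR : e ∉ R := fun h => he (Finset.mem_sdiff.2 ⟨h, heQ⟩)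
      rw [hM i (Finset.mem_sdiff.1 hi).1 e heR, mul_apply, Finset.sum_eq_zero, sub_zero]
      intro f _
      by_cases hf : f ∈ Q
      · rw [hM f (hQ hf) e heR, mul_zero]
      · rw [multipliers_eq_zero_right i hf, zero_mul]
  rw [transpose_sub, mul_sub, transpose_one, mul_one, Matrix.sub_apply, hX j hj, mul_apply,
    Finset.sum_eq_zero, sub_zero]
  intro e _
  rw [transpose_apply, multipliers_eq_zero_left hj, mul_zero]

end Multipliers

/-! ### Quadratic forms under elimination. -/

section Pivots

variable {α β : Type} [DecidableEq α] [DecidableEq β]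
  {K M L : Matrix (α ⊕ β) (α ⊕ β) ℝ} {R Q : Finset (α ⊕ β)}

lemma IsPivot.subset (h : IsPivot R M Q) : Q ⊆ R := by
  rcases h with ⟨a, ha, rfl, -⟩ | ⟨b, hb, rfl, -⟩ | ⟨a, b, ha, hb, rfl, -⟩
  · simpa using ha
  · simpa using hb
  · intro i hi
    rcases Finset.mem_insert.1 hi with rfl | hi
    · exact ha
    · rwa [Finset.mem_singleton.1 hi]

lemma det_submatrix_singleton {ι : Type} [DecidableEq ι] (M : Matrix ι ι ℝ) (i : ι) :
    (M.submatrix (fun j : {j // j ∈ ({i} : Finset ι)} => j.1) (fun j => j.1)).det = M i i := by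
  have : Unique {j // j ∈ ({i} : Finset ι)} :=
    { default := ⟨i, by simp⟩, uniq := fun j => Subtype.ext (Finset.mem_singleton.1 j.2) }
  rw [det_unique, submatrix_apply]
  rw [Finset.mem_singleton.1 (default : {j // j ∈ ({i} : Finset ι)}).2]

lemma det_submatrix_pair {ι : Type} [DecidableEq ι] (M : Matrix ι ι ℝ) {i j : ι} (hij : i ≠ j) :
    (M.submatrix (fun e : {e // e ∈ ({i, j} : Finset ι)} => e.1) (fun e => e.1)).det
      = M i i * M j j - M i j * M j i := by
  let e : Fin 2 → {e // e ∈ ({i, j} : Finset ι)} := ![⟨i, by simp⟩, ⟨j, by simp⟩]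
  have he : Function.Bijective e := by
    constructor
    · intro s t hst
      fin_cases s <;> fin_cases t <;> simp_all [e]
    · rintro ⟨t, ht⟩
      rcases Finset.mem_insert.1 ht with rfl | ht
      · exact ⟨0, rfl⟩
      · exact ⟨1, Subtype.ext (Finset.mem_singleton.1 ht).symm⟩
  rw [← det_submatrix_equiv_self (Equiv.ofBijective e he), det_fin_two]
  rfl

lemma IsPivot.det_ne_zero (h : IsPivot R M Q) :
    (M.submatrix (fun i : {i // i ∈ Q} => i.1) (fun i : {i // i ∈ Q} => i.1)).det ≠ 0 := by
  rcases h with ⟨a, ha, rfl, h⟩ | ⟨b, hb, rfl, h⟩ | ⟨a, b, ha, hb, rfl, h⟩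
  · rw [det_submatrix_singleton]; exact h.ne'
  · rw [det_submatrix_singleton]; exact h.ne
  · rw [det_submatrix_pair M (by simp)]; exact h.ne

variable [Fintype α] [Fintype β]

/-- For an indefinite binary form and every value of the first variable there is a value of the second
one where the form is nonnegative. -/
lemma exists_binary_form_nonneg {h d e : ℝ} (hdet : h * d - e * e < 0) (s : ℝ) :
    ∃ t : ℝ, 0 ≤ h * s * s + 2 * e * s * t + d * t * t := by
  by_cases hd : d = 0
  · subst hd
    have he : e ≠ 0 := by rintro rfl; simp at hdet
    -- The form is affine in `t` here, and this is its zero.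
    refine ⟨-h * s / (2 * e), le_of_eq ?_⟩
    field_simp
    ring
  · refine ⟨(√(e * e - h * d) - e) * s / d, le_of_eq ?_⟩
    have hs : √(e * e - h * d) * √(e * e - h * d) = e * e - h * d :=
      Real.mul_self_sqrt (by linarith)
    set r := √(e * e - h * d)
    field_simp
    linear_combination (-s ^ 2) * hs

/-- The dual entries on a pivot can be chosen so that the form of the pivot is nonnegative. -/
lemma IsPivot.exists_nonneg (hM : M.IsSymm) (h : IsPivot R M Q) (s : α ⊕ β → ℝ)
    (hs : ∀ i ∉ Q, s i = 0) :
    ∃ Y : α ⊕ β → ℝ, (∀ i ∉ Q, Y i = 0) ∧ (∀ a, Y (Sum.inl a) = s (Sum.inl a)) ∧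
      0 ≤ Y ⬝ᵥ (M *ᵥ Y) := by
  rcases h with ⟨a, ha, rfl, h⟩ | ⟨b, hb, rfl, h⟩ | ⟨a, b, ha, hb, rfl, h⟩
  · refine ⟨s, hs, fun _ => rfl, ?_⟩
    have : s = Pi.single (Sum.inl a) (s (Sum.inl a)) := by
      ext i
      by_cases hi : i = Sum.inl a
      · subst hi; simp
      · rw [hs i (by simpa using hi), Pi.single_eq_of_ne hi]
    rw [this, mulVec_single, single_dotProduct]
    simp only [Pi.smul_apply, MulOpposite.smul_eq_mul_unop, MulOpposite.unop_op, col_apply]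
    nlinarith [mul_self_nonneg (s (Sum.inl a))]
  · refine ⟨0, fun _ _ => rfl, fun a => (hs _ (by simp)).symm, by simp⟩
  · rw [hM.apply (Sum.inl a) (Sum.inr b)] at h
    obtain ⟨t, ht⟩ := exists_binary_form_nonneg h (s (Sum.inl a))
    refine ⟨Pi.single (Sum.inl a) (s (Sum.inl a)) + Pi.single (Sum.inr b) t, ?_, ?_, ?_⟩
    · intro i hi
      simp only [Finset.mem_insert, Finset.mem_singleton, not_or] at hi
      simp [Pi.single_eq_of_ne hi.1, Pi.single_eq_of_ne hi.2]
    · intro a'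
      by_cases ha' : a' = a
      · subst ha'; simp
      · rw [hs (Sum.inl a') (by simp [ha'])]
        simp [ha']
    · rw [mulVec_add, mulVec_single, mulVec_single, add_dotProduct, single_dotProduct,
        single_dotProduct]
      simp only [Pi.smul_apply, Pi.add_apply, MulOpposite.smul_eq_mul_unop, MulOpposite.unop_op,
        col_apply]
      rw [hM.apply (Sum.inl a) (Sum.inr b)]
      linarith

/-- `z` on `R` and zero elsewhere. -/
def restrictTo {ι : Type} [DecidableEq ι] (R : Finset ι) (z : ι → ℝ) : ι → ℝ :=
  fun i => if i ∈ R then z i else 0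

lemma restrictTo_of_mem {ι : Type} [DecidableEq ι] {R : Finset ι} {z : ι → ℝ} {i : ι}
    (h : i ∈ R) : restrictTo R z i = z i := if_pos h

lemma restrictTo_of_notMem {ι : Type} [DecidableEq ι] {R : Finset ι} {z : ι → ℝ} {i : ι}
    (h : i ∉ R) : restrictTo R z i = 0 := if_neg h

lemma transpose_multipliers_mulVec_congr {ι : Type} [Fintype ι] [DecidableEq ι] {R Q : Finset ι}
    {M : Matrix ι ι ℝ} {y z : ι → ℝ} (h : ∀ i ∈ R \ Q, y i = z i) :
    (multipliers R Q M)ᵀ *ᵥ y = (multipliers R Q M)ᵀ *ᵥ z := by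
  ext j
  simp only [mulVec, dotProduct, transpose_apply]
  refine Finset.sum_congr rfl fun i _ => ?_
  by_cases hi : i ∈ R \ Q
  · rw [h i hi]
  · rw [multipliers_eq_zero_left hi, zero_mul, zero_mul]

lemma transpose_multipliers_mulVec_apply {ι : Type} [Fintype ι] [DecidableEq ι] {R Q : Finset ι}
    {M : Matrix ι ι ℝ} {z : ι → ℝ} {j : ι} (hj : j ∉ Q) :
    ((multipliers R Q M)ᵀ *ᵥ z) j = 0 := by
  simp only [mulVec, dotProduct, transpose_apply]
  exact Finset.sum_eq_zero fun i _ => by rw [multipliers_eq_zero_right i hj, zero_mul]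

lemma dotProduct_mulVec_congruence {ι : Type} [Fintype ι] [DecidableEq ι] (M T : Matrix ι ι ℝ)
    (y : ι → ℝ) : y ⬝ᵥ ((T * M * Tᵀ) *ᵥ y) = (Tᵀ *ᵥ y) ⬝ᵥ (M *ᵥ (Tᵀ *ᵥ y)) := by
  rw [← mulVec_mulVec, ← mulVec_mulVec, dotProduct_mulVec, mulVec_transpose]

lemma dotProduct_mulVec_eq_zero {ι : Type} [Fintype ι] {M : Matrix ι ι ℝ} {y z : ι → ℝ}
    (h : ∀ i j, y i = 0 ∨ z j = 0 ∨ M i j = 0) : y ⬝ᵥ (M *ᵥ z) = 0 := by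
  simp only [mulVec, dotProduct]
  refine Finset.sum_eq_zero fun i _ => ?_
  rw [Finset.mul_sum]
  refine Finset.sum_eq_zero fun j _ => ?_
  rcases h i j with h | h | h <;> simp [h]

/-- One elimination step: a vector on `R` can be changed in the dual entries of the pivot so that
its form dominates the form of the Schur complement. -/
lemma IsPivot.exists_form_ge (hM : M.IsSymm) (hMR : ∀ i ∈ R, ∀ j ∉ R, M i j = 0)
    (h : IsPivot R M Q) (z : α ⊕ β → ℝ) (hz : ∀ i ∉ R, z i = 0) :
    ∃ z' : α ⊕ β → ℝ, (∀ i ∉ R, z' i = 0) ∧ (∀ a, z' (Sum.inl a) = z (Sum.inl a)) ∧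
      (∀ i ∈ R \ Q, z' i = z i) ∧
      restrictTo (R \ Q) z ⬝ᵥ (((1 - multipliers R Q M) * M * (1 - multipliers R Q M)ᵀ) *ᵥ
        restrictTo (R \ Q) z) ≤ z' ⬝ᵥ (M *ᵥ z') := by
  have hQ := h.subset
  -- Adding `Nᵀ z` on the pivot anticipates the change of variables `(1 - N)ᵀ`, which subtracts it
  -- again, so that the primal entries end up as those of `z`.
  obtain ⟨Y, hY, hYs, hYM⟩ := h.exists_nonneg hM
    ((multipliers R Q M)ᵀ *ᵥ z + restrictTo Q z) (by
      intro i hi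
      rw [Pi.add_apply, transpose_multipliers_mulVec_apply hi, restrictTo_of_notMem hi, add_zero])
  set N := multipliers R Q M with hN
  set y := restrictTo (R \ Q) z + Y with hy
  have hyz : ∀ i ∈ R \ Q, y i = z i := by
    intro i hi
    rw [hy, Pi.add_apply, restrictTo_of_mem hi, hY i (Finset.mem_sdiff.1 hi).2, add_zero]
  have hNy : Nᵀ *ᵥ y = Nᵀ *ᵥ z := transpose_multipliers_mulVec_congr hyz
  have hNY : Nᵀ *ᵥ Y = 0 := by
    rw [← mulVec_zero Nᵀ]
    exact transpose_multipliers_mulVec_congr fun i hi => hY i (Finset.mem_sdiff.1 hi).2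
  have hz' : (1 - N)ᵀ *ᵥ y = y - Nᵀ *ᵥ z := by
    rw [transpose_sub, transpose_one, sub_mulVec, one_mulVec, hNy]
  refine ⟨(1 - N)ᵀ *ᵥ y, ?_, ?_, ?_, ?_⟩
  · intro i hi
    have hiQ : i ∉ Q := fun h' => hi (hQ h')
    rw [hz', Pi.sub_apply, transpose_multipliers_mulVec_apply hiQ, hy, Pi.add_apply, hY i hiQ,
      restrictTo_of_notMem (fun h' => hi (Finset.mem_sdiff.1 h').1)]
    simp
  · intro a
    rw [hz', Pi.sub_apply, hy, Pi.add_apply, hYs, Pi.add_apply]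
    by_cases ha : Sum.inl a ∈ Q
    · rw [restrictTo_of_mem ha, restrictTo_of_notMem (by simp [ha])]
      ring
    · rw [restrictTo_of_notMem ha]
      by_cases haR : Sum.inl a ∈ R
      · rw [restrictTo_of_mem (by simp [ha, haR])]
        ring
      · rw [restrictTo_of_notMem (by simp [haR]), hz _ haR]
        ring
  · intro i hi
    rw [hz', Pi.sub_apply, hyz i hi,
      transpose_multipliers_mulVec_apply (Finset.mem_sdiff.1 hi).2, sub_zero]
  · rw [← dotProduct_mulVec_congruence]
    set M' := (1 - N) * M * (1 - N)ᵀ with hM'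
    have hsymm : M'.IsSymm := by
      rw [IsSymm, hM', transpose_mul, transpose_mul, transpose_transpose, hM.eq, mul_assoc]
    -- In the new variables the form splits into the Schur complement part and the pivot part, and
    -- the latter is nonnegative by the choice of `Y`.
    have hcross : ∀ i j, restrictTo (R \ Q) z i = 0 ∨ Y j = 0 ∨ M' i j = 0 := by
      intro i j
      by_cases hi : i ∈ R \ Q
      · by_cases hj : j ∈ Q
        · exact Or.inr (Or.inr (schur_apply_eq_zero h.det_ne_zero hMR hQ hi
            fun h' => (Finset.mem_sdiff.1 h').2 hj))
        · exact Or.inr (Or.inl (hY j hj))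
      · exact Or.inl (restrictTo_of_notMem hi)
    have hYM' : Y ⬝ᵥ (M' *ᵥ Y) = Y ⬝ᵥ (M *ᵥ Y) := by
      rw [hM', dotProduct_mulVec_congruence, transpose_sub, transpose_one, sub_mulVec, one_mulVec,
        hNY, sub_zero]
    rw [hy, mulVec_add, dotProduct_add, add_dotProduct, add_dotProduct, hYM',
      dotProduct_mulVec_eq_zero hcross,
      dotProduct_mulVec_eq_zero (y := Y) (z := restrictTo (R \ Q) z) fun i j => by
        rcases hcross j i with h | h | h
        · exact Or.inr (Or.inl h)
        · exact Or.inl h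
        · exact Or.inr (Or.inr (by rw [← hsymm.apply, h]))]
    linarith

namespace PartialLBL

lemma isSymm (hK : K.IsSymm) (h : PartialLBL K R L M) : M.IsSymm := by
  induction h with
  | start => exact hK
  | pivot R L M Q _ _ ih =>
    rw [IsSymm, transpose_mul, transpose_mul, transpose_transpose, ih.eq, mul_assoc]

lemma one_add_multipliers_mul_one_sub {ι : Type} [Fintype ι] [DecidableEq ι] (R Q : Finset ι)
    (M : Matrix ι ι ℝ) : (1 + multipliers R Q M) * (1 - multipliers R Q M) = 1 := by
  rw [add_mul, one_mul, mul_sub, mul_one, multipliers_mul_self]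
  abel

lemma factorization (h : PartialLBL K R L M) : K = L * M * Lᵀ := by
  induction h with
  | start => simp
  | pivot R L M Q _ _ ih =>
    set N := multipliers R Q M with hN
    have h1 : (1 + N) * (1 - N) = 1 := one_add_multipliers_mul_one_sub R Q M
    have h2 : (1 - N)ᵀ * (1 + N)ᵀ = 1 := by rw [← transpose_mul, h1, transpose_one]
    calc K = L * ((1 + N) * (1 - N)) * M * ((1 - N)ᵀ * (1 + N)ᵀ) * Lᵀ := by
          rw [h1, h2, ih, mul_one, mul_one]
      _ = _ := by rw [transpose_mul]; simp only [mul_assoc]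

lemma isUnit (h : PartialLBL K R L M) : IsUnit L := by
  induction h with
  | start => exact isUnit_one
  | pivot R L M Q _ _ ih =>
    exact ih.mul (IsUnit.of_mul_eq_one _ (one_add_multipliers_mul_one_sub R Q M))

/-- A later multiplier block only alters the columns of its own pivot, so columns not yet eliminated
are still unit vectors. -/
lemma factor_apply (h : PartialLBL K R L M) : ∀ j ∈ R, ∀ i, L i j = (1 : Matrix _ _ ℝ) i j := by
  induction h with
  | start => intros; rfl
  | pivot R L M Q _ _ ih =>
    intro j hj i
    rw [mul_add, mul_one, Matrix.add_apply, ih j (Finset.mem_sdiff.1 hj).1, mul_apply,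
      Finset.sum_eq_zero, add_zero]
    intro e _
    rw [multipliers_eq_zero_right e (Finset.mem_sdiff.1 hj).2, mul_zero]

lemma decoupled (h : PartialLBL K R L M) : ∀ i ∈ R, ∀ j ∉ R, M i j = 0 := by
  induction h with
  | start => intro i _ j hj; exact absurd (Finset.mem_univ j) hj
  | pivot R L M Q _ hQ ih =>
    intro i hi j hj
    exact schur_apply_eq_zero hQ.det_ne_zero ih hQ.subset hi hj

/-- Every vector can be changed in its eliminated dual entries so that its form dominates the form
of the Schur complement. -/
lemma exists_form_ge (hK : K.IsSymm) (h : PartialLBL K R L M) : ∀ z : α ⊕ β → ℝ,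
    ∃ z' : α ⊕ β → ℝ, (∀ a, z' (Sum.inl a) = z (Sum.inl a)) ∧ (∀ i ∈ R, z' i = z i) ∧
      restrictTo R z ⬝ᵥ (M *ᵥ restrictTo R z) ≤ z' ⬝ᵥ (K *ᵥ z') := by
  induction h with
  | start =>
    intro z
    have : restrictTo Finset.univ z = z := by ext i; simp [restrictTo]
    exact ⟨z, fun _ => rfl, fun _ _ => rfl, by rw [this]⟩
  | pivot R L M Q h hQ ih =>
    intro z
    obtain ⟨z₁, h₁, h₂, h₃, h₄⟩ := hQ.exists_form_ge (h.isSymm hK) h.decoupled (restrictTo R z)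
      fun i hi => restrictTo_of_notMem hi
    have hr : restrictTo (R \ Q) (restrictTo R z) = restrictTo (R \ Q) z := by
      ext i
      simp only [restrictTo, Finset.mem_sdiff]
      split_ifs <;> tauto
    -- Outside `R` the entries of `z` are put back, because the primal ones among them must survive
    -- the earlier pivots.
    obtain ⟨z₂, g₁, g₂, g₃⟩ := ih (fun i => if i ∈ R then z₁ i else z i)
    have hr₂ : restrictTo R (fun i => if i ∈ R then z₁ i else z i) = z₁ := by
      ext i
      by_cases hi : i ∈ R
      · simp [restrictTo, hi]
      · simp [restrictTo, hi, h₁ i hi]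
    refine ⟨z₂, ?_, ?_, ?_⟩
    · intro i
      rw [g₁]
      split_ifs with hi
      · rw [h₂, restrictTo_of_mem hi]
      · rfl
    · intro i hi
      have hiR := (Finset.mem_sdiff.1 hi).1
      rw [g₂ i hiR, if_pos hiR, h₃ i hi, restrictTo_of_mem hiR]
    · rw [hr₂] at g₃
      rw [hr] at h₄
      exact h₄.trans g₃

end PartialLBL

end Pivots

/-! ### Curvature directions from KKT matrices. -/

section Curvature

variable {α β : Type} [DecidableEq β]

lemma kkt_isSymm {H : Matrix α α ℝ} (hH : H.IsSymm) (J : Matrix β α ℝ) (μ : ℝ) :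
    (fromBlocks H Jᵀ J (-(μ • (1 : Matrix β β ℝ)))).IsSymm :=
  IsSymm.fromBlocks hH (transpose_transpose J) (by simp [IsSymm])

variable [Fintype α] [Fintype β]

/-- Completing the square in the dual variables of the form of a KKT matrix. -/
lemma kkt_form {μ : ℝ} (hμ : 0 < μ) (H : Matrix α α ℝ) (J : Matrix β α ℝ) (z : α ⊕ β → ℝ) :
    z ⬝ᵥ (fromBlocks H Jᵀ J (-(μ • (1 : Matrix β β ℝ))) *ᵥ z)
      = (z ∘ Sum.inl) ⬝ᵥ ((H + (1 / μ) • (Jᵀ * J)) *ᵥ (z ∘ Sum.inl))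
        - μ * ((z ∘ Sum.inr - (1 / μ) • (J *ᵥ (z ∘ Sum.inl))) ⬝ᵥ
          (z ∘ Sum.inr - (1 / μ) • (J *ᵥ (z ∘ Sum.inl)))) := by
  set u := z ∘ Sum.inl with hu
  set w := z ∘ Sum.inr with hw
  have hz : z = Sum.elim u w := by ext (i | i) <;> rfl
  have h1 : u ⬝ᵥ (Jᵀ *ᵥ w) = (J *ᵥ u) ⬝ᵥ w := by rw [dotProduct_mulVec, vecMul_transpose]
  have h2 : u ⬝ᵥ ((Jᵀ * J) *ᵥ u) = (J *ᵥ u) ⬝ᵥ (J *ᵥ u) := by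
    rw [← mulVec_mulVec, dotProduct_mulVec, vecMul_transpose]
  rw [fromBlocks_mulVec, ← hu, ← hw, hz, sumElim_dotProduct_sumElim, add_mulVec, smul_mulVec,
    neg_mulVec, smul_mulVec, one_mulVec]
  simp only [dotProduct_add, dotProduct_sub, sub_dotProduct, dotProduct_smul, smul_dotProduct,
    dotProduct_neg, smul_eq_mul, h1, h2, dotProduct_comm w (J *ᵥ u)]
  field_simp
  ring

variable [DecidableEq α]
  {μ : ℝ} {H : Matrix α α ℝ} {J : Matrix β α ℝ} {R : Finset (α ⊕ β)}
  {L S : Matrix (α ⊕ β) (α ⊕ β) ℝ}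

/-- When no admissible pivot is left, all the dual variables have been eliminated. -/
lemma PartialLBL.inr_notMem (hμ : 0 < μ) (hH : H.IsSymm)
    (h : PartialLBL (fromBlocks H Jᵀ J (-(μ • (1 : Matrix β β ℝ)))) R L S)
    (hS : ∀ Q, ¬ IsPivot R S Q) (b : β) : Sum.inr b ∉ R := by
  intro hb
  -- With zero primal part and a nonzero dual part, the KKT form is negative. It dominates the
  -- diagonal entry of the Schur complement at `b`, so that entry would be an admissible pivot.
  obtain ⟨z, h1, h2, h3⟩ := h.exists_form_ge (kkt_isSymm hH J μ) (Pi.single (Sum.inr b) 1)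
  have hr : restrictTo R (Pi.single (Sum.inr b) (1 : ℝ)) = Pi.single (Sum.inr b) 1 := by
    ext i
    by_cases hi : i ∈ R
    · rw [restrictTo_of_mem hi]
    · rw [restrictTo_of_notMem hi, Pi.single_eq_of_ne]
      rintro rfl
      exact hi hb
  have hu : z ∘ Sum.inl = 0 := by
    ext i
    simp [h1 i]
  have hw : 0 < (z ∘ Sum.inr) ⬝ᵥ (z ∘ Sum.inr) := by
    have h0 : (z ∘ Sum.inr) b = 1 := by simp [h2 _ hb]
    rw [dotProduct]
    refine lt_of_lt_of_le ?_ (Finset.single_le_sum (f := fun i => (z ∘ Sum.inr) i * (z ∘ Sum.inr) i)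
      (fun i _ => mul_self_nonneg _) (Finset.mem_univ b))
    simp only [h0]
    norm_num
  rw [hr, kkt_form hμ, hu, mulVec_single_one, single_one_dotProduct] at h3
  simp only [mulVec_zero, smul_zero, sub_zero, dotProduct_zero, zero_sub, col_apply] at h3
  refine hS {Sum.inr b} (Or.inr (Or.inl ⟨b, hb, rfl, ?_⟩))
  have := mul_pos hμ hw
  linarith

lemma hVec_apply_of_ne {ι : Type} [DecidableEq ι] {S : Matrix ι ι ℝ} {q r i : ι} (hq : i ≠ q)
    (hr : i ≠ r) : hVec S q r i = 0 := by
  unfold hVec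
  split_ifs <;> simp [Pi.single_eq_of_ne hq, Pi.single_eq_of_ne hr]

lemma hVec_apply_left_ne_zero {ι : Type} [DecidableEq ι] (S : Matrix ι ι ℝ) (q r : ι) :
    hVec S q r q ≠ 0 := by
  unfold hVec
  split_ifs with h
  · simp
  · simp [Pi.single_eq_of_ne h]

/-- The diagonal terms are nonpositive, and the sign in `h` turns the cross term into `-|S q r|`. -/
lemma hVec_form_le {ι : Type} [Fintype ι] [DecidableEq ι] {S : Matrix ι ι ℝ} (hS : S.IsSymm)
    {q r : ι} (hq : S q q ≤ 0) (hr : S r r ≤ 0) :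
    hVec S q r ⬝ᵥ (S *ᵥ hVec S q r) ≤ -|S q r| := by
  unfold hVec
  split_ifs with h
  · subst h
    simp [abs_of_nonpos hq]
  · have h2 : (1 / √2) * (1 / √2) = (1 / 2 : ℝ) := by
      rw [div_mul_div_comm, Real.mul_self_sqrt (by norm_num)]; norm_num
    have habs : Real.sign (S q r) * S q r = |S q r| := by
      rcases lt_trichotomy (S q r) 0 with h | h | h
      · rw [Real.sign_of_neg h, abs_of_neg h]; ring
      · simp [h]
      · rw [Real.sign_of_pos h, abs_of_pos h]; ring
    simp only [mulVec_smul, mulVec_sub, dotProduct_smul, smul_dotProduct, sub_dotProduct,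
      mulVec_single_one, single_one_dotProduct, dotProduct_sub, smul_eq_mul, col_apply,
      hS.apply q r]
    have hsr := mul_nonneg (mul_self_nonneg (Real.sign (S q r))) (neg_nonneg.2 hr)
    linear_combination (1 / 2) * hq + (1 / 2) * hsr - habs
      + (S q q - 2 * (Real.sign (S q r) * S q r)
        + Real.sign (S q r) * Real.sign (S q r) * S r r) * h2

/-- If the curvature computation returns no direction, then `H + (1/μ) JᵀJ` is positive
semidefinite. -/
lemma IsCurvatureVector.form_nonneg (hμ : 0 < μ) (hH : H.IsSymm) {z : α ⊕ β → ℝ}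
    (hz : IsCurvatureVector (fromBlocks H Jᵀ J (-(μ • (1 : Matrix β β ℝ)))) z)
    (h0 : z ∘ Sum.inl = 0) (u : α → ℝ) : 0 ≤ u ⬝ᵥ ((H + (1 / μ) • (Jᵀ * J)) *ᵥ u) := by
  obtain ⟨R, L, S, hL, hS, hz⟩ := hz
  have hR := hL.inr_notMem hμ hH hS
  have hS0 : ∀ i ∈ R, ∀ j ∈ R, S i j = 0 := by
    rcases hz with ⟨rfl, -⟩ | ⟨q, hq, r, hr, hmax, hz⟩
    · simp
    -- Column `q` of `L` is a unit vector and `q` is a primal index, so this entry is the primal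
    -- entry `z q`. As `h` does not vanish at `q`, the largest entry of the Schur complement must be
    -- zero.
    · have hzq : (Lᵀ *ᵥ z) q = 0 := by
        simp only [mulVec, dotProduct, transpose_apply, hL.factor_apply q hq]
        refine Finset.sum_eq_zero fun i _ => ?_
        by_cases hi : i = q
        · subst hi
          rcases i with a | b
          · rw [show z (Sum.inl a) = 0 from congrFun h0 a, mul_zero]
          · exact absurd hq (hR b)
        · rw [one_apply_ne hi, zero_mul]
      rw [hz, Pi.smul_apply, smul_eq_mul, mul_eq_zero,
        or_iff_left (hVec_apply_left_ne_zero S q r), Real.sqrt_eq_zero (abs_nonneg _)] at hzq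
      intro i hi j hj
      have := hmax i hi j hj
      rw [hzq] at this
      exact abs_eq_zero.1 (le_antisymm this (abs_nonneg _))
  -- The Schur complement vanishes, so some choice of dual entries makes the KKT form nonnegative.
  -- Completing the square bounds it above by the form at `u`.
  obtain ⟨z', h1, -, h3⟩ := hL.exists_form_ge (kkt_isSymm hH J μ) (Sum.elim u 0)
  rw [dotProduct_mulVec_eq_zero fun i j => ?_, kkt_form hμ] at h3
  · have hu : z' ∘ Sum.inl = u := by ext i; simp [h1 i]
    rw [hu] at h3
    have := mul_nonneg hμ.le (Finset.sum_nonneg fun b (_ : b ∈ Finset.univ) =>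
      mul_self_nonneg ((z' ∘ Sum.inr - (1 / μ) • (J *ᵥ u)) b))
    change 0 ≤ μ * (_ ⬝ᵥ _) at this
    linarith
  · by_cases hi : i ∈ R
    · by_cases hj : j ∈ R
      · exact Or.inr (Or.inr (hS0 i hi j hj))
      · exact Or.inr (Or.inl (restrictTo_of_notMem hj))
    · exact Or.inl (restrictTo_of_notMem hi)

/-- A direction returned by the curvature computation has negative curvature. -/
lemma IsCurvatureVector.form_neg (hμ : 0 < μ) (hH : H.IsSymm) {z : α ⊕ β → ℝ}
    (hz : IsCurvatureVector (fromBlocks H Jᵀ J (-(μ • (1 : Matrix β β ℝ)))) z)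
    (h0 : z ∘ Sum.inl ≠ 0) :
    (z ∘ Sum.inl) ⬝ᵥ ((H + (1 / μ) • (Jᵀ * J)) *ᵥ (z ∘ Sum.inl)) < 0 := by
  obtain ⟨R, L, S, hL, hS, hz⟩ := hz
  have hR := hL.inr_notMem hμ hH hS
  have hSsymm := hL.isSymm (kkt_isSymm hH J μ)
  have hdiag : ∀ i ∈ R, S i i ≤ 0 := by
    rintro (a | b) hi
    · by_contra h
      exact hS {Sum.inl a} (Or.inl ⟨a, hi, rfl, not_le.1 h⟩)
    · exact absurd hi (hR b)
  rcases hz with ⟨-, rfl⟩ | ⟨q, hq, r, hr, hmax, hz⟩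
  · exact absurd rfl h0
  set ρ := |S q r| with hρ
  have hρ0 : 0 < ρ := by
    refine lt_of_le_of_ne (abs_nonneg _) fun h => h0 ?_
    rw [← h, Real.sqrt_zero, zero_smul] at hz
    have hz0 : z = 0 := by
      apply mulVec_injective_of_isUnit ((isUnit_transpose L).2 hL.isUnit)
      rw [hz, mulVec_zero]
    rw [hz0]
    rfl
  have hh : ∀ i ∉ R, hVec S q r i = 0 := fun i hi =>
    hVec_apply_of_ne (by rintro rfl; exact hi hq) (by rintro rfl; exact hi hr)
  have hSh : ∀ i ∉ R, (S *ᵥ hVec S q r) i = 0 := by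
    intro i hi
    rw [mulVec, dotProduct]
    refine Finset.sum_eq_zero fun j _ => ?_
    by_cases hj : j ∈ R
    · rw [← hSsymm.apply, hL.decoupled j hj i hi, zero_mul]
    · rw [hh j hj, mul_zero]
  have hLv : ∀ v : α ⊕ β → ℝ, (∀ i ∉ R, v i = 0) → L *ᵥ v = v := by
    intro v hv
    nth_rewrite 2 [← one_mulVec v]
    ext i
    simp only [mulVec, dotProduct]
    refine Finset.sum_congr rfl fun j _ => ?_
    by_cases hj : j ∈ R
    · rw [hL.factor_apply j hj]
    · rw [hv j hj, mul_zero, mul_zero]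
  -- The product is supported on the remaining indices, all primal. Its zero dual rows say that the
  -- square completed in `kkt_form` vanishes at `z`.
  have hKz : fromBlocks H Jᵀ J (-(μ • (1 : Matrix β β ℝ))) *ᵥ z
      = √ρ • (S *ᵥ hVec S q r) := by
    rw [hL.factorization, ← mulVec_mulVec, ← mulVec_mulVec, hz, mulVec_smul, mulVec_smul,
      hLv _ hSh]
  have hw : z ∘ Sum.inr - (1 / μ) • (J *ᵥ (z ∘ Sum.inl)) = 0 := by
    ext b
    have h1 := congrFun hKz (Sum.inr b)
    rw [Pi.smul_apply, hSh _ (hR b), smul_zero, fromBlocks_mulVec, Sum.elim_inr, Pi.add_apply,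
      neg_mulVec, smul_mulVec, one_mulVec] at h1
    simp only [Pi.neg_apply, Pi.smul_apply, smul_eq_mul] at h1
    simp only [Pi.sub_apply, Pi.smul_apply, smul_eq_mul, Pi.zero_apply]
    field_simp
    linarith
  have hform := kkt_form hμ H J z
  rw [hw, dotProduct_zero, mul_zero, sub_zero, hL.factorization, dotProduct_mulVec_congruence, hz,
    mulVec_smul, dotProduct_smul, smul_dotProduct, smul_eq_mul, smul_eq_mul, ← mul_assoc,
    Real.mul_self_sqrt hρ0.le] at hform
  rw [← hform]
  have := hVec_form_le hSsymm (hdiag q hq) (hdiag r hr)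
  exact mul_neg_of_pos_of_neg hρ0 (by linarith)

end Curvature

/-! ### Derivatives along lines, in place of derivatives of composite maps. -/

section LineDerivatives

variable {E F : Type*} [NormedAddCommGroup E] [NormedSpace ℝ E] [NormedAddCommGroup F]
  [NormedSpace ℝ F]

lemma hasDerivAt_line {f : E → F} (hf : Differentiable ℝ f) (x d : E) (t : ℝ) :
    HasDerivAt (fun t : ℝ => f (x + t • d)) (fderiv ℝ f (x + t • d) d) t := by
  have h : HasDerivAt (fun t : ℝ => x + t • d) d t := by
    simpa using ((hasDerivAt_id t).smul_const d).const_add x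
  exact (hf (x + t • d)).hasFDerivAt.comp_hasDerivAt t h

lemma hasDerivAt_fderiv_line {f : E → F} (hf : ContDiff ℝ 2 f) (x d : E) :
    HasDerivAt (fun t : ℝ => fderiv ℝ f (x + t • d) d) (fderiv ℝ (fderiv ℝ f) x d d) 0 := by
  have h1 : Differentiable ℝ (fderiv ℝ f) :=
    (hf.fderiv_right (m := 1) (by norm_num)).differentiable (by norm_num)
  have h2 := (hasDerivAt_line h1 x d 0).clm_apply (hasDerivAt_const (0 : ℝ) d)
  simpa using h2

lemma fderiv_apply_eq_of_line {f : E → F} (hf : Differentiable ℝ f) {x d : E} {l : F}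
    (h : HasDerivAt (fun t : ℝ => f (x + t • d)) l 0) : fderiv ℝ f x d = l := by
  simpa using (hasDerivAt_line hf x d 0).unique h

lemma fderiv_fderiv_apply_eq_of_line {f : E → F} (hf : ContDiff ℝ 2 f) {x d : E} {l : F}
    (h : HasDerivAt (fun t : ℝ => fderiv ℝ f (x + t • d) d) l 0) :
    fderiv ℝ (fderiv ℝ f) x d d = l :=
  (hasDerivAt_fderiv_line hf x d).unique h

end LineDerivatives

/-! ### Matrices and bilinear forms in coordinates. -/

section Coordinates

variable {n m : ℕ}

lemma sum_smul_single (d : Vec n) : ∑ i, d i • (EuclideanSpace.single i 1 : Vec n) = d := by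
  ext j
  simp [Pi.single_apply]

lemma inner_eq_dotProduct (a b : Vec n) : inner ℝ a b = a.ofLp ⬝ᵥ b.ofLp := by
  rw [EuclideanSpace.inner_eq_star_dotProduct, star_trivial, dotProduct_comm]

lemma dotProduct_of_bilin (B : Vec n →L[ℝ] Vec n →L[ℝ] ℝ) (d e : Vec n) :
    d.ofLp ⬝ᵥ ((Matrix.of fun i j => B (EuclideanSpace.single i 1) (EuclideanSpace.single j 1)) *ᵥ
      e.ofLp) = B d e := by
  conv_rhs => rw [← sum_smul_single d, ← sum_smul_single e]
  simp only [map_sum, _root_.sum_apply, map_smul, _root_.smul_apply,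
    smul_eq_mul, mulVec, dotProduct, of_apply, Finset.mul_sum]
  rw [Finset.sum_comm]
  refine Finset.sum_congr rfl fun i _ => Finset.sum_congr rfl fun j _ => ?_
  ring

end Coordinates

/-! ### Derivatives of the merit function and the QP form. -/

namespace NLP

variable {n m : ℕ} (P : NLP n m)

lemma jac_mulVec (x d : Vec n) : P.jac x *ᵥ d.ofLp = (fderiv ℝ P.c x d).ofLp := by
  ext i
  conv_rhs => rw [← sum_smul_single d]
  simp only [map_sum, map_smul, jac, mulVec, dotProduct, of_apply]
  simp [mul_comm]

lemma dotProduct_transpose_jac_mul_jac (x d e : Vec n) :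
    d.ofLp ⬝ᵥ (((P.jac x)ᵀ * P.jac x) *ᵥ e.ofLp)
      = inner ℝ (fderiv ℝ P.c x d) (fderiv ℝ P.c x e) := by
  rw [← mulVec_mulVec, dotProduct_mulVec, vecMul_transpose, jac_mulVec, jac_mulVec,
    inner_eq_dotProduct]

lemma contDiff_lagrangian (hf : ContDiff ℝ 2 P.f) (hc : ContDiff ℝ 2 P.c) (y : Vec m) :
    ContDiff ℝ 2 fun t : Vec n => P.f t - inner ℝ (P.c t) y :=
  hf.sub (hc.inner ℝ contDiff_const)

lemma lagHess_isSymm (hf : ContDiff ℝ 2 P.f) (hc : ContDiff ℝ 2 P.c) (x : Vec n) (y : Vec m) :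
    (P.lagHess x y).IsSymm := by
  refine IsSymm.ext fun i j => ?_
  have h : IsSymmSndFDerivAt ℝ (fun t : Vec n => P.f t - inner ℝ (P.c t) y) x :=
    (P.contDiff_lagrangian hf hc y).contDiffAt.isSymmSndFDerivAt (by simp)
  exact h.eq _ _

/-- The form of `H(x, y) + (1/μ) J(x)ᵀ J(x)`. -/
lemma reducedHess_form (hf : ContDiff ℝ 2 P.f) (hc : ContDiff ℝ 2 P.c) (μ : ℝ) (x : Vec n)
    (y : Vec m) (d : Vec n) :
    d.ofLp ⬝ᵥ ((P.lagHess x y + (1 / μ) • ((P.jac x)ᵀ * P.jac x)) *ᵥ d.ofLp)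
      = fderiv ℝ (fderiv ℝ P.f) x d d - inner ℝ (fderiv ℝ (fderiv ℝ P.c) x d d) y
        + 1 / μ * ‖fderiv ℝ P.c x d‖ ^ 2 := by
  have hf1 := hf.differentiable (by norm_num)
  have hc1 := hc.differentiable (by norm_num)
  have hl := P.contDiff_lagrangian hf hc y
  have h1 : ∀ t : Vec n, fderiv ℝ (fun t : Vec n => P.f t - inner ℝ (P.c t) y) t d
      = fderiv ℝ P.f t d - inner ℝ (fderiv ℝ P.c t d) y := by
    intro t
    refine fderiv_apply_eq_of_line (hl.differentiable (by norm_num)) ?_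
    have := (hasDerivAt_line hf1 t d 0).fun_sub
      ((hasDerivAt_line hc1 t d 0).inner ℝ (hasDerivAt_const (0 : ℝ) y))
    simpa using this
  have h2 : fderiv ℝ (fderiv ℝ fun t : Vec n => P.f t - inner ℝ (P.c t) y) x d d
      = fderiv ℝ (fderiv ℝ P.f) x d d - inner ℝ (fderiv ℝ (fderiv ℝ P.c) x d d) y := by
    refine fderiv_fderiv_apply_eq_of_line hl ?_
    simp only [h1]
    have := (hasDerivAt_fderiv_line hf x d).fun_sub
      ((hasDerivAt_fderiv_line hc x d).inner ℝ (hasDerivAt_const (0 : ℝ) y))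
    simpa using this
  rw [add_mulVec, dotProduct_add, smul_mulVec, dotProduct_smul, dotProduct_transpose_jac_mul_jac,
    real_inner_self_eq_norm_sq, smul_eq_mul, lagHess, dotProduct_of_bilin, h2]

lemma contDiff_merit (hf : ContDiff ℝ 2 P.f) (hc : ContDiff ℝ 2 P.c) (ν : ℝ) (yE : Vec m) (μ : ℝ) :
    ContDiff ℝ 2 (P.merit ν yE μ) := by
  have hf' : ContDiff ℝ 2 fun v : Vec n × Vec m => P.f v.1 := hf.comp contDiff_fst
  have hc' : ContDiff ℝ 2 fun v : Vec n × Vec m => P.c v.1 := hc.comp contDiff_fst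
  exact ((hf'.sub (hc'.inner ℝ contDiff_const)).add (contDiff_const.mul (hc'.norm_sq ℝ))).add
    (contDiff_const.mul
      ((hc'.add ((contDiff_snd.sub contDiff_const).const_smul μ)).norm_sq ℝ))

lemma meritSlope_eq (hf : ContDiff ℝ 2 P.f) (hc : ContDiff ℝ 2 P.c) (ν : ℝ) (yE : Vec m) {μ : ℝ}
    (v d : Vec n × Vec m) :
    P.meritSlope ν yE μ v d = fderiv ℝ P.f v.1 d.1 - inner ℝ (fderiv ℝ P.c v.1 d.1) yE
      + 1 / μ * inner ℝ (P.c v.1) (fderiv ℝ P.c v.1 d.1)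
      + ν / μ * inner ℝ (P.c v.1 + μ • (v.2 - yE)) (fderiv ℝ P.c v.1 d.1 + μ • d.2) := by
  have hf1 := hasDerivAt_line (hf.differentiable (by norm_num)) v.1 d.1 0
  have hc1 := hasDerivAt_line (hc.differentiable (by norm_num)) v.1 d.1 0
  have hy : HasDerivAt (fun t : ℝ => v.2 + t • d.2) d.2 0 := by
    simpa using ((hasDerivAt_id (0 : ℝ)).smul_const d.2).const_add v.2
  refine fderiv_apply_eq_of_line ((P.contDiff_merit hf hc ν yE μ).differentiable (by norm_num)) ?_
  have := ((hf1.sub (hc1.inner ℝ (hasDerivAt_const (0 : ℝ) yE))).add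
    (hc1.norm_sq.const_mul (1 / (2 * μ)))).add
    ((hc1.add ((hy.sub_const yE).const_smul μ)).norm_sq.const_mul (ν / (2 * μ)))
  refine this.congr_deriv ?_
  simp only [zero_smul, add_zero, inner_zero_right, zero_add, Pi.add_apply, Pi.smul_apply]
  ring

lemma meritCurv_eq (hf : ContDiff ℝ 2 P.f) (hc : ContDiff ℝ 2 P.c) (ν : ℝ) (yE : Vec m) {μ : ℝ}
    (v d : Vec n × Vec m) :
    P.meritCurv ν yE μ v d = fderiv ℝ (fderiv ℝ P.f) v.1 d.1 d.1
      - inner ℝ (fderiv ℝ (fderiv ℝ P.c) v.1 d.1 d.1) yE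
      + 1 / μ * (inner ℝ (P.c v.1) (fderiv ℝ (fderiv ℝ P.c) v.1 d.1 d.1)
        + ‖fderiv ℝ P.c v.1 d.1‖ ^ 2)
      + ν / μ * (inner ℝ (P.c v.1 + μ • (v.2 - yE)) (fderiv ℝ (fderiv ℝ P.c) v.1 d.1 d.1)
        + ‖fderiv ℝ P.c v.1 d.1 + μ • d.2‖ ^ 2) := by
  have hf2 := hasDerivAt_fderiv_line hf v.1 d.1
  have hc1 := hasDerivAt_line (hc.differentiable (by norm_num)) v.1 d.1 0
  have hc2 := hasDerivAt_fderiv_line hc v.1 d.1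
  have hy : HasDerivAt (fun t : ℝ => v.2 + t • d.2) d.2 0 := by
    simpa using ((hasDerivAt_id (0 : ℝ)).smul_const d.2).const_add v.2
  refine fderiv_fderiv_apply_eq_of_line (P.contDiff_merit hf hc ν yE μ) ?_
  have hs := fun v' => P.meritSlope_eq hf hc ν yE (μ := μ) v' d
  simp only [meritSlope] at hs
  simp only [hs, Prod.fst_add, Prod.smul_fst, Prod.snd_add, Prod.smul_snd]
  have := ((hf2.sub (hc2.inner ℝ (hasDerivAt_const (0 : ℝ) yE))).add
    ((hc1.inner ℝ hc2).const_mul (1 / μ))).add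
    (((hc1.add ((hy.sub_const yE).const_smul μ)).inner ℝ (hc2.add_const (μ • d.2))).const_mul
      (ν / μ))
  refine this.congr_deriv ?_
  simp only [zero_smul, add_zero, inner_zero_right, zero_add, Pi.add_apply, Pi.smul_apply,
    real_inner_self_eq_norm_sq]

/-- The curvature of the merit function along `(u, -(1/μ) J u)`. -/
lemma meritCurv_eq_reducedHess (hf : ContDiff ℝ 2 P.f) (hc : ContDiff ℝ 2 P.c) (ν : ℝ)
    (yE : Vec m) {μ : ℝ} (hμ : 0 < μ) (v : Vec n × Vec m) (u : Vec n) :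
    P.meritCurv ν yE μ v (u, (-(1 / μ)) • fderiv ℝ P.c v.1 u)
      = u.ofLp ⬝ᵥ ((P.lagHess v.1 v.2 + (1 / μ) • ((P.jac v.1)ᵀ * P.jac v.1)) *ᵥ u.ofLp)
        + (1 + ν) / μ *
          inner ℝ (P.c v.1 + μ • (v.2 - yE)) (fderiv ℝ (fderiv ℝ P.c) v.1 u u) := by
  -- This choice of dual component annihilates the last square of the Hessian. What remains compares
  -- the multiplier `y` with those implicit in the merit function, whence the residual `c + μ (y -
  -- yE)`.
  have h0 : fderiv ℝ P.c v.1 u + μ • (-(1 / μ)) • fderiv ℝ P.c v.1 u = 0 := by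
    rw [smul_smul, mul_neg, mul_one_div_cancel hμ.ne', neg_one_smul, add_neg_cancel]
  rw [P.meritCurv_eq hf hc, P.reducedHess_form hf hc, h0, norm_zero]
  simp only [inner_add_left, inner_smul_left, inner_sub_left, RCLike.conj_to_real,
    real_inner_comm yE, real_inner_comm v.2]
  field_simp
  ring

lemma meritGradX_apply (hf : ContDiff ℝ 2 P.f) (hc : ContDiff ℝ 2 P.c) (ν : ℝ) (yE : Vec m)
    (μ : ℝ) (x : Vec n) (y : Vec m) (i : Fin n) :
    P.meritGradX ν yE μ x y i = P.meritSlope ν yE μ (x, y) (EuclideanSpace.single i 1, 0) := by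
  have hM : Differentiable ℝ (P.merit ν yE μ) :=
    (P.contDiff_merit hf hc ν yE μ).differentiable (by norm_num)
  have h1 : HasFDerivAt (fun t => P.merit ν yE μ (t, y))
      ((fderiv ℝ (P.merit ν yE μ) (x, y)).comp (ContinuousLinearMap.inl ℝ (Vec n) (Vec m))) x :=
    HasFDerivAt.comp (f := fun t : Vec n => (t, y)) x (hM (x, y)).hasFDerivAt
      (hasFDerivAt_prodMk_left x y)
  have h2 : inner ℝ (P.meritGradX ν yE μ x y) (EuclideanSpace.single i 1)
      = P.meritSlope ν yE μ (x, y) (EuclideanSpace.single i 1, 0) := by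
    rw [meritGradX, gradient, InnerProductSpace.toDual_symm_apply, h1.fderiv]
    rfl
  rw [← h2]
  simp [EuclideanSpace.inner_single_right]

lemma meritGradY_eq (hf : ContDiff ℝ 2 P.f) (hc : ContDiff ℝ 2 P.c) (ν : ℝ) (yE : Vec m)
    {μ : ℝ} (hμ : 0 < μ) (x : Vec n) (y : Vec m) :
    P.meritGradY ν yE μ x y = ν • (P.c x + μ • (y - yE)) := by
  have hM : Differentiable ℝ (P.merit ν yE μ) :=
    (P.contDiff_merit hf hc ν yE μ).differentiable (by norm_num)
  have h1 : HasFDerivAt (fun t => P.merit ν yE μ (x, t))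
      ((fderiv ℝ (P.merit ν yE μ) (x, y)).comp (ContinuousLinearMap.inr ℝ (Vec n) (Vec m))) y :=
    HasFDerivAt.comp (f := fun t : Vec m => (x, t)) y (hM (x, y)).hasFDerivAt
      (hasFDerivAt_prodMk_right x y)
  refine ext_inner_right ℝ fun d => ?_
  have h2 : inner ℝ (P.meritGradY ν yE μ x y) d = P.meritSlope ν yE μ (x, y) (0, d) := by
    rw [meritGradY, gradient, InnerProductSpace.toDual_symm_apply, h1.fderiv]
    rfl
  rw [h2, P.meritSlope_eq hf hc]
  simp only [map_zero, inner_zero_left, inner_zero_right, zero_add, inner_smul_right,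
    inner_smul_left, RCLike.conj_to_real]
  field_simp
  ring

/-- The bilinear form of the QP Hessian. -/
lemma qpHess_form (ν : ℝ) {μ : ℝ} (hμ : 0 < μ) (x : Vec n) (B : Matrix (Fin n) (Fin n) ℝ)
    (d e : Vec n × Vec m) :
    Sum.elim d.1.ofLp d.2.ofLp ⬝ᵥ (P.qpHess ν μ x B *ᵥ Sum.elim e.1.ofLp e.2.ofLp)
      = d.1.ofLp ⬝ᵥ (B *ᵥ e.1.ofLp) + 1 / μ * inner ℝ (fderiv ℝ P.c x d.1) (fderiv ℝ P.c x e.1)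
        + ν / μ * inner ℝ (fderiv ℝ P.c x d.1 + μ • d.2) (fderiv ℝ P.c x e.1 + μ • e.2) := by
  rw [qpHess, fromBlocks_mulVec, sumElim_dotProduct_sumElim]
  simp only [Sum.elim_comp_inl, Sum.elim_comp_inr, add_mulVec, smul_mulVec, one_mulVec,
    dotProduct_add, dotProduct_smul, dotProduct_transpose_jac_mul_jac, jac_mulVec]
  have h1 : d.1.ofLp ⬝ᵥ ((P.jac x)ᵀ *ᵥ e.2.ofLp) = inner ℝ (fderiv ℝ P.c x d.1) e.2 := by
    rw [dotProduct_mulVec, vecMul_transpose, jac_mulVec, inner_eq_dotProduct]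
  rw [h1, ← inner_eq_dotProduct d.2, ← inner_eq_dotProduct d.2]
  simp only [inner_add_left, inner_add_right, inner_smul_left, inner_smul_right,
    RCLike.conj_to_real, smul_eq_mul]
  field_simp
  ring

end NLP

/-! ### Norm estimates and elementary inequalities. -/

section Norms

variable {n m : ℕ}

lemma norm_le_card_mul {v : Vec n} {C : ℝ} (h : ∀ i, |v i| ≤ C) : ‖v‖ ≤ n * C := by
  calc ‖v‖ = ‖∑ i, v i • (EuclideanSpace.single i 1 : Vec n)‖ := by rw [sum_smul_single]
    _ ≤ ∑ i, ‖v i • (EuclideanSpace.single i 1 : Vec n)‖ := norm_sum_le _ _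
    _ ≤ ∑ _i : Fin n, C := Finset.sum_le_sum fun i _ => by
        rw [norm_smul, PiLp.norm_single, norm_one, mul_one, Real.norm_eq_abs]
        exact h i
    _ = n * C := by simp

lemma abs_apply_le_norm (v : Vec n) (i : Fin n) : |v i| ≤ ‖v‖ := by
  simpa using PiLp.norm_apply_le v i

lemma abs_mulVec_apply_le {B : Matrix (Fin n) (Fin n) ℝ} {C : ℝ} (h : ∀ i j, |B i j| ≤ C)
    (v : Vec n) (i : Fin n) : |(B *ᵥ v.ofLp) i| ≤ n * C * ‖v‖ := by
  calc |(B *ᵥ v.ofLp) i| ≤ ∑ j, |B i j * v j| := by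
        rw [mulVec, dotProduct]
        exact Finset.abs_sum_le_sum_abs _ _
    _ ≤ ∑ _j : Fin n, C * ‖v‖ := Finset.sum_le_sum fun j _ => by
        rw [abs_mul]
        exact mul_le_mul (h i j) (abs_apply_le_norm v j) (abs_nonneg _)
          ((abs_nonneg _).trans (h i j))
    _ = n * C * ‖v‖ := by simp [mul_assoc]

lemma pairNorm_nonneg (p : Vec n) (q : Vec m) : 0 ≤ pairNorm p q := Real.sqrt_nonneg _

lemma pairNorm_sq (p : Vec n) (q : Vec m) : pairNorm p q ^ 2 = ‖p‖ ^ 2 + ‖q‖ ^ 2 :=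
  Real.sq_sqrt (by positivity)

lemma norm_fst_le_pairNorm (p : Vec n) (q : Vec m) : ‖p‖ ≤ pairNorm p q :=
  Real.le_sqrt_of_sq_le (by nlinarith [sq_nonneg ‖q‖])

lemma norm_snd_le_pairNorm (p : Vec n) (q : Vec m) : ‖q‖ ≤ pairNorm p q :=
  Real.le_sqrt_of_sq_le (by nlinarith [sq_nonneg ‖p‖])

lemma abs_min_le_of_min_eq_zero {x p g r : ℝ} (h : min (x + p) (g + r) = 0) :
    |min x g| ≤ |p| + |r| := by
  have h1 : |min x g - min (x + p) (g + r)| ≤ max |x - (x + p)| |g - (g + r)| :=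
    abs_min_sub_min_le_max _ _ _ _
  rw [h, sub_zero, show x - (x + p) = -p by ring, show g - (g + r) = -r by ring, abs_neg,
    abs_neg] at h1
  exact h1.trans (max_le_add_of_nonneg (abs_nonneg _) (abs_nonneg _))

lemma nonneg_of_quadratic_nonneg {A B T : ℝ} (hT : 0 < T)
    (h : ∀ t, 0 ≤ t → t ≤ T → 0 ≤ t * A + t ^ 2 * B) : 0 ≤ A := by
  by_contra hA
  push Not at hA
  -- A step so short that the quadratic term cannot compensate a negative linear term.
  set t := min T (-A / (2 * (|B| + 1))) with ht
  have hB : 0 < |B| + 1 := by positivity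
  have ht0 : 0 < t := lt_min hT (div_pos (by linarith) (by linarith))
  have h1 : t * (2 * (|B| + 1)) ≤ -A := by
    rw [← le_div_iff₀ (by linarith)]
    exact min_le_right _ _
  have h2 := h t ht0.le (min_le_left _ _)
  have h3 : t * A + t ^ 2 * B = t * (A + t * B) := by ring
  rw [h3] at h2
  have h4 : 0 ≤ A + t * B := nonneg_of_mul_nonneg_right h2 ht0
  have h5 : t * B ≤ t * |B| := mul_le_mul_of_nonneg_left (le_abs_self B) ht0.le
  nlinarith

end Norms

/-! ### Optimality and descent properties of the QP step. -/

namespace NLP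

variable {n m : ℕ} (P : NLP n m)

/-- `d` minimizes the objective of the QP subproblem at `v` over the steps that keep the bounds. -/
def IsQPSolution (ν : ℝ) (yE : Vec m) (μ : ℝ) (B : Matrix (Fin n) (Fin n) ℝ)
    (v d : Vec n × Vec m) : Prop :=
  (∀ i, 0 ≤ v.1 i + d.1 i) ∧ ∀ e : Vec n × Vec m, (∀ i, 0 ≤ v.1 i + e.1 i) →
    P.qpObj ν yE μ B v d ≤ P.qpObj ν yE μ B v e

/-- The directional derivative of the QP objective at `d` in the direction `e`. -/
noncomputable def qpSlope (ν : ℝ) (yE : Vec m) (μ : ℝ) (B : Matrix (Fin n) (Fin n) ℝ)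
    (v d e : Vec n × Vec m) : ℝ :=
  P.meritSlope ν yE μ v e + Sum.elim e.1.ofLp e.2.ofLp ⬝ᵥ
    (P.qpHess ν μ v.1 B *ᵥ Sum.elim d.1.ofLp d.2.ofLp)

variable {P} {ν μ : ℝ} {yE : Vec m} {B : Matrix (Fin n) (Fin n) ℝ} {v d : Vec n × Vec m}

lemma qpHess_isSymm (hB : B.IsSymm) (x : Vec n) : (P.qpHess ν μ x B).IsSymm := by
  refine IsSymm.fromBlocks ?_ ?_ ?_
  · simp [IsSymm, hB.eq]
  · simp
  · simp [IsSymm]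

lemma qpObj_add_smul (hB : B.IsSymm) (e : Vec n × Vec m) (t : ℝ) :
    P.qpObj ν yE μ B v (d + t • e) = P.qpObj ν yE μ B v d + t * P.qpSlope ν yE μ B v d e
      + t ^ 2 * (1 / 2 * (Sum.elim e.1.ofLp e.2.ofLp ⬝ᵥ
        (P.qpHess ν μ v.1 B *ᵥ Sum.elim e.1.ofLp e.2.ofLp))) := by
  have h1 : Sum.elim (d + t • e).1.ofLp (d + t • e).2.ofLp
      = Sum.elim d.1.ofLp d.2.ofLp + t • Sum.elim e.1.ofLp e.2.ofLp := by
    ext (i | i) <;> simp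
  have h2 : Sum.elim d.1.ofLp d.2.ofLp ⬝ᵥ (P.qpHess ν μ v.1 B *ᵥ Sum.elim e.1.ofLp e.2.ofLp)
      = Sum.elim e.1.ofLp e.2.ofLp ⬝ᵥ (P.qpHess ν μ v.1 B *ᵥ Sum.elim d.1.ofLp d.2.ofLp) := by
    rw [dotProduct_comm, dotProduct_mulVec, ← mulVec_transpose, (qpHess_isSymm hB v.1).eq,
      dotProduct_comm]
  rw [qpObj, qpObj, qpSlope, h1, meritSlope, meritSlope, meritSlope, map_add, map_smul]
  simp only [mulVec_add, mulVec_smul, dotProduct_add, add_dotProduct, dotProduct_smul,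
    smul_dotProduct, smul_eq_mul, h2]
  ring

lemma IsQPSolution.qpSlope_nonneg (h : P.IsQPSolution ν yE μ B v d) (hB : B.IsSymm)
    (e : Vec n × Vec m) {T : ℝ} (hT : 0 < T)
    (he : ∀ t, 0 ≤ t → t ≤ T → ∀ i, 0 ≤ v.1 i + d.1 i + t * e.1 i) :
    0 ≤ P.qpSlope ν yE μ B v d e := by
  refine nonneg_of_quadratic_nonneg (B := 1 / 2 * (Sum.elim e.1.ofLp e.2.ofLp ⬝ᵥ
        (P.qpHess ν μ v.1 B *ᵥ Sum.elim e.1.ofLp e.2.ofLp))) hT fun t h0 h1 => ?_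
  have := h.2 (d + t • e) fun i => by
    have := he t h0 h1 i
    simpa [add_assoc] using this
  rw [qpObj_add_smul hB] at this
  linarith

lemma qpSlope_neg (e : Vec n × Vec m) :
    P.qpSlope ν yE μ B v d (-e) = -P.qpSlope ν yE μ B v d e := by
  have h1 : Sum.elim (-e).1.ofLp (-e).2.ofLp = -Sum.elim e.1.ofLp e.2.ofLp := by
    ext (i | i) <;> simp
  rw [qpSlope, qpSlope, h1, meritSlope, meritSlope, map_neg, neg_dotProduct]
  ring

/-- The zero step is feasible, so the QP objective cannot decrease from `d` towards it. -/
lemma IsQPSolution.slope_le (h : P.IsQPSolution ν yE μ B v d) (hB : B.IsSymm)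
    (hv : ∀ i, 0 ≤ v.1 i) :
    P.meritSlope ν yE μ v d ≤ -(Sum.elim d.1.ofLp d.2.ofLp ⬝ᵥ
      (P.qpHess ν μ v.1 B *ᵥ Sum.elim d.1.ofLp d.2.ofLp)) := by
  have h1 := h.qpSlope_nonneg hB (-d) one_pos fun t h0 h1 i => by
    have h2 := mul_nonneg (sub_nonneg.2 h1) (h.1 i)
    have h3 := mul_nonneg h0 (hv i)
    simp only [Prod.fst_neg, PiLp.neg_apply]
    linarith
  rw [qpSlope_neg, qpSlope] at h1
  linarith

/-- The dual variables are unconstrained, so the QP gradient in them vanishes; it is `ν` times the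
sum of the two sides. -/
lemma IsQPSolution.residual_eq (h : P.IsQPSolution ν yE μ B v d) (hf : ContDiff ℝ 2 P.f)
    (hc : ContDiff ℝ 2 P.c) (hν : 0 < ν) (hμ : 0 < μ) (hB : B.IsSymm) :
    P.c v.1 + μ • (v.2 - yE) = -(fderiv ℝ P.c v.1 d.1 + μ • d.2) := by
  rw [← add_eq_zero_iff_eq_neg]
  refine ext_inner_right ℝ fun e => ?_
  have hfeas : ∀ e' : Vec m, 0 ≤ P.qpSlope ν yE μ B v d (0, e') := fun e' =>
    h.qpSlope_nonneg hB (0, e') one_pos fun t _ _ i => by simpa using h.1 i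
  have h1 := hfeas e
  have h2 := hfeas (-e)
  rw [show ((0, -e) : Vec n × Vec m) = -(0, e) by simp, qpSlope_neg] at h2
  have h3 : P.qpSlope ν yE μ B v d (0, e) = 0 := le_antisymm (by linarith) h1
  rw [qpSlope, P.meritSlope_eq hf hc, P.qpHess_form ν hμ] at h3
  simp only [map_zero, inner_zero_left, inner_zero_right, WithLp.ofLp_zero, zero_dotProduct,
    zero_add, mul_zero, add_zero, sub_zero, inner_smul_right, inner_smul_left,
    RCLike.conj_to_real] at h3
  rw [inner_zero_left, inner_add_left, real_inner_comm e (fderiv ℝ P.c v.1 d.1 + μ • d.2)]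
  field_simp at h3
  exact (mul_eq_zero.1 h3).resolve_left hν.ne'

lemma IsQPSolution.min_eq_zero (h : P.IsQPSolution ν yE μ B v d) (hB : B.IsSymm) (i : Fin n) :
    min (v.1 i + d.1 i) (P.qpSlope ν yE μ B v d (EuclideanSpace.single i 1, 0)) = 0 := by
  have h1 : 0 ≤ P.qpSlope ν yE μ B v d (EuclideanSpace.single i 1, 0) :=
    h.qpSlope_nonneg hB _ one_pos fun t ht _ j => by
      refine add_nonneg (h.1 j) (mul_nonneg ht ?_)
      by_cases hj : j = i <;> simp [hj]
  rcases (h.1 i).eq_or_lt with h0 | h0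
  · rw [← h0, min_eq_left h1]
  -- An inactive bound leaves room to move backwards by its slack, so the slope vanishes.
  · have h2 := h.qpSlope_nonneg hB (-(EuclideanSpace.single i 1, 0)) h0 fun t ht ht' j => by
      by_cases hj : j = i
      · subst hj; simpa using ht'
      · simpa [hj] using h.1 j
    rw [qpSlope_neg] at h2
    rw [le_antisymm (by linarith) h1, min_eq_right h0.le]

/-- The optimality conditions of the bound-constrained merit function are violated by at most a
multiple of the QP step. -/
lemma exists_optimality_bound (hf : ContDiff ℝ 2 P.f) (hc : ContDiff ℝ 2 P.c) (hν : 0 < ν)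
    (hμ : 0 < μ) (CJ CB : ℝ) : ∃ C : ℝ, 0 < C ∧ ∀ (yE : Vec m) (B : Matrix (Fin n) (Fin n) ℝ)
      (x : Vec n) (y : Vec m) (p : Vec n) (q : Vec m), B.IsSymm → (∀ i j, |B i j| ≤ CB) →
      ‖fderiv ℝ P.c x‖ ≤ CJ → P.IsQPSolution ν yE μ B (x, y) (p, q) →
      ‖P.c x + μ • (y - yE)‖ ≤ C * pairNorm p q ∧
      ‖P.meritGradY ν yE μ x y‖ ≤ C * pairNorm p q ∧
      ‖vmin x (P.meritGradX ν yE μ x y)‖ ≤ C * pairNorm p q := by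
  -- `C₁` bounds the map `(p, q) ↦ J p + μ q`; `C₂` bounds the change of both arguments of the
  -- minimum when passing from `v` to `v + d` in the QP model.
  set C₁ := |CJ| + μ with hC₁
  set C₂ := 1 + (n * |CB| + 1 / μ * (|CJ| * |CJ|) + ν / μ * (|CJ| * C₁)) with hC₂
  have hC₁0 : 0 < C₁ := by positivity
  have hC₂0 : 0 < C₂ := by positivity
  refine ⟨C₁ + ν * C₁ + n * C₂, by positivity, fun yE B x y p q hB hBC hJ h => ?_⟩
  set N := pairNorm p q with hN
  have hN0 : 0 ≤ N := pairNorm_nonneg p q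
  have hp : ‖p‖ ≤ N := norm_fst_le_pairNorm p q
  have hq : ‖q‖ ≤ N := norm_snd_le_pairNorm p q
  have hA : ∀ e, ‖fderiv ℝ P.c x e‖ ≤ |CJ| * ‖e‖ := fun e =>
    ((fderiv ℝ P.c x).le_opNorm e).trans
      (mul_le_mul_of_nonneg_right (hJ.trans (le_abs_self _)) (norm_nonneg _))
  have hAp : ‖fderiv ℝ P.c x p‖ ≤ |CJ| * N :=
    (hA p).trans (mul_le_mul_of_nonneg_left hp (abs_nonneg _))
  have hr : ‖fderiv ℝ P.c x p + μ • q‖ ≤ C₁ * N := by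
    calc ‖fderiv ℝ P.c x p + μ • q‖ ≤ ‖fderiv ℝ P.c x p‖ + ‖μ • q‖ := norm_add_le _ _
      _ ≤ |CJ| * N + μ * N := by
          rw [norm_smul, Real.norm_of_nonneg hμ.le]
          exact add_le_add hAp (mul_le_mul_of_nonneg_left hq hμ.le)
      _ = C₁ * N := by ring
  have hg : ‖P.c x + μ • (y - yE)‖ ≤ C₁ * N := by
    have h1 := h.residual_eq hf hc hν hμ hB
    rw [h1, norm_neg]
    exact hr
  have hνC : 0 ≤ ν * C₁ * N := by positivity
  have hnC : 0 ≤ n * C₂ * N := by positivity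
  have hC₁N : 0 ≤ C₁ * N := by positivity
  refine ⟨by linarith, ?_, ?_⟩
  · rw [P.meritGradY_eq hf hc ν yE hμ, norm_smul, Real.norm_of_nonneg hν.le]
    have := mul_le_mul_of_nonneg_left hg hν.le
    linarith
  · have hi : ∀ i, |vmin x (P.meritGradX ν yE μ x y) i| ≤ C₂ * N := by
      intro i
      have h1 := h.min_eq_zero hB i
      rw [qpSlope, ← P.meritGradX_apply hf hc] at h1
      refine (abs_min_le_of_min_eq_zero h1).trans ?_
      rw [P.qpHess_form ν hμ]
      simp only [smul_zero, add_zero]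
      set e : Vec n := EuclideanSpace.single i 1 with he
      have he1 : ‖fderiv ℝ P.c x e‖ ≤ |CJ| := by
        have := hA e
        rwa [he, PiLp.norm_single, norm_one, mul_one] at this
      have t1 : |e.ofLp ⬝ᵥ (B *ᵥ p.ofLp)| ≤ n * |CB| * N := by
        have : e.ofLp ⬝ᵥ (B *ᵥ p.ofLp) = (B *ᵥ p.ofLp) i := by
          rw [he, EuclideanSpace.single]
          simp
        rw [this]
        exact (abs_mulVec_apply_le (fun i j => (hBC i j).trans (le_abs_self _)) p i).trans
          (mul_le_mul_of_nonneg_left hp (by positivity))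
      have t2 : |1 / μ * inner ℝ (fderiv ℝ P.c x e) (fderiv ℝ P.c x p)|
          ≤ 1 / μ * (|CJ| * (|CJ| * N)) := by
        rw [abs_mul, abs_of_pos (by positivity : 0 < 1 / μ)]
        refine mul_le_mul_of_nonneg_left ((abs_real_inner_le_norm _ _).trans ?_) (by positivity)
        exact mul_le_mul he1 hAp (norm_nonneg _) (abs_nonneg _)
      have t3 : |ν / μ * inner ℝ (fderiv ℝ P.c x e) (fderiv ℝ P.c x p + μ • q)|
          ≤ ν / μ * (|CJ| * (C₁ * N)) := by
        rw [abs_mul, abs_of_pos (by positivity : 0 < ν / μ)]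
        refine mul_le_mul_of_nonneg_left ((abs_real_inner_le_norm _ _).trans ?_) (by positivity)
        exact mul_le_mul he1 hr (norm_nonneg _) (abs_nonneg _)
      have t0 : |p i| ≤ N := (abs_apply_le_norm p i).trans hp
      have t4 := abs_add_three (e.ofLp ⬝ᵥ (B *ᵥ p.ofLp))
        (1 / μ * inner ℝ (fderiv ℝ P.c x e) (fderiv ℝ P.c x p))
        (ν / μ * inner ℝ (fderiv ℝ P.c x e) (fderiv ℝ P.c x p + μ • q))
      have t5 : C₂ * N = N + (n * |CB| * N + 1 / μ * (|CJ| * (|CJ| * N))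
          + ν / μ * (|CJ| * (C₁ * N))) := by
        rw [hC₂]; ring
      rw [t5]
      exact add_le_add t0 (t4.trans (add_le_add (add_le_add t1 t2) t3))
    have := norm_le_card_mul hi
    linarith

/-- The QP step is a direction of sufficient descent. -/
lemma exists_descent_bound (hν : 0 < ν) (hμ : 0 < μ) (CJ : ℝ) {l : ℝ} (hl : 0 < l) :
    ∃ C : ℝ, 0 < C ∧ ∀ (yE : Vec m) (B : Matrix (Fin n) (Fin n) ℝ)
      (x : Vec n) (y : Vec m) (p : Vec n) (q : Vec m), B.IsSymm → (∀ i, 0 ≤ x i) →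
      ‖fderiv ℝ P.c x‖ ≤ CJ →
      l * ‖p‖ ^ 2 ≤ p.ofLp ⬝ᵥ ((B + (1 / μ) • ((P.jac x)ᵀ * P.jac x)) *ᵥ p.ofLp) →
      P.IsQPSolution ν yE μ B (x, y) (p, q) →
      P.meritSlope ν yE μ (x, y) (p, q) ≤ -(C * pairNorm p q ^ 2) := by
  -- The form bounds `‖p‖` and `r = J p + μ q` separately; `‖q‖` is recovered from `μ q = r - J p`,
  -- and `a` collects the resulting weight of `‖p‖²`.
  set a := 1 + 2 * CJ ^ 2 / μ ^ 2 with ha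
  have ha0 : 0 < a := by positivity
  refine ⟨min (l / a) (ν * μ / 2), lt_min (by positivity) (by positivity),
    fun yE B x y p q hB hx hJ hl' h => (h.slope_le hB hx).trans (neg_le_neg ?_)⟩
  set c := min (l / a) (ν * μ / 2) with hc
  have hc0 : 0 < c := lt_min (by positivity) (by positivity)
  have hca : c * a ≤ l := (le_div_iff₀ ha0).1 (min_le_left _ _)
  have hcν : c ≤ ν * μ / 2 := min_le_right _ _
  rw [P.qpHess_form ν hμ, real_inner_self_eq_norm_sq, real_inner_self_eq_norm_sq, pairNorm_sq]
  rw [add_mulVec, dotProduct_add, smul_mulVec, dotProduct_smul,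
    P.dotProduct_transpose_jac_mul_jac, real_inner_self_eq_norm_sq, smul_eq_mul] at hl'
  simp only
  set r := fderiv ℝ P.c x p + μ • q with hr
  have hAp : ‖fderiv ℝ P.c x p‖ ≤ CJ * ‖p‖ :=
    ((fderiv ℝ P.c x).le_opNorm p).trans (mul_le_mul_of_nonneg_right hJ (norm_nonneg _))
  have hq : μ * ‖q‖ ≤ ‖r‖ + CJ * ‖p‖ := by
    calc μ * ‖q‖ = ‖r - fderiv ℝ P.c x p‖ := by
          rw [hr, add_sub_cancel_left, norm_smul, Real.norm_of_nonneg hμ.le]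
      _ ≤ ‖r‖ + ‖fderiv ℝ P.c x p‖ := norm_sub_le _ _
      _ ≤ ‖r‖ + CJ * ‖p‖ := by linarith
  have hq2 : ‖q‖ ^ 2 ≤ (2 * ‖r‖ ^ 2 + 2 * CJ ^ 2 * ‖p‖ ^ 2) / μ ^ 2 := by
    rw [le_div_iff₀ (by positivity)]
    have h1 : (μ * ‖q‖) ^ 2 ≤ (‖r‖ + CJ * ‖p‖) ^ 2 := pow_le_pow_left₀ (by positivity) hq 2
    nlinarith [sq_nonneg (‖r‖ - CJ * ‖p‖)]
  have h3 : c * (‖p‖ ^ 2 + ‖q‖ ^ 2) ≤ c * a * ‖p‖ ^ 2 + c * (2 / μ ^ 2) * ‖r‖ ^ 2 := by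
    have := mul_le_mul_of_nonneg_left hq2 hc0.le
    have h4 : c * ((2 * ‖r‖ ^ 2 + 2 * CJ ^ 2 * ‖p‖ ^ 2) / μ ^ 2)
        = c * (2 * CJ ^ 2 / μ ^ 2) * ‖p‖ ^ 2 + c * (2 / μ ^ 2) * ‖r‖ ^ 2 := by ring
    rw [ha]
    linarith
  have h4 : c * a * ‖p‖ ^ 2 ≤ l * ‖p‖ ^ 2 := mul_le_mul_of_nonneg_right hca (sq_nonneg _)
  have h5 : c * (2 / μ ^ 2) * ‖r‖ ^ 2 ≤ ν / μ * ‖r‖ ^ 2 := by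
    refine mul_le_mul_of_nonneg_right ?_ (sq_nonneg _)
    calc c * (2 / μ ^ 2) ≤ ν * μ / 2 * (2 / μ ^ 2) :=
          mul_le_mul_of_nonneg_right hcν (by positivity)
      _ = ν / μ := by field_simp
  linarith

end NLP

/-! ### Restriction to the free variables. -/

lemma dotProduct_submatrix_mulVec {n : ℕ} (W : Matrix (Fin n) (Fin n) ℝ) (F : Finset (Fin n))
    {d : Fin n → ℝ} (hd : ∀ i ∉ F, d i = 0) :
    (fun i : {i // i ∈ F} => d i) ⬝ᵥ
      (W.submatrix (fun i : {i // i ∈ F} => i.1) (fun i : {i // i ∈ F} => i.1) *ᵥ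
        fun i : {i // i ∈ F} => d i) = d ⬝ᵥ (W *ᵥ d) := by
  have hsum : ∀ g : Fin n → ℝ, (∀ i ∉ F, g i = 0) → ∑ i : {i // i ∈ F}, g i = ∑ i, g i := by
    intro g hg
    rw [Finset.sum_coe_sort F g]
    exact Finset.sum_subset (Finset.subset_univ _) fun i _ hi => hg i hi
  simp only [dotProduct, mulVec, submatrix_apply]
  rw [← hsum (fun i => d i * ∑ j, W i j * d j) fun i hi => by rw [hd i hi, zero_mul]]
  refine Finset.sum_congr rfl fun i _ => ?_
  rw [hsum (fun j => W i j * d j) fun j hj => by rw [hd j hj, mul_zero]]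

lemma NLP.submatrix_reducedHess {n m : ℕ} (P : NLP n m) (μ : ℝ) (x : Vec n) (y : Vec m)
    (F : Finset (Fin n)) :
    (P.lagHess x y).submatrix (fun i : {i // i ∈ F} => i.1) (fun i : {i // i ∈ F} => i.1)
      + (1 / μ) • (((P.jac x).submatrix id (fun i : {i // i ∈ F} => i.1))ᵀ
        * (P.jac x).submatrix id (fun i : {i // i ∈ F} => i.1))
      = (P.lagHess x y + (1 / μ) • ((P.jac x)ᵀ * P.jac x)).submatrix
        (fun i : {i // i ∈ F} => i.1) (fun i : {i // i ∈ F} => i.1) := by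
  ext i j
  simp [mul_apply]

/-! ### Properties of a single iteration. -/

namespace Iterates

variable {n m : ℕ} {s : Iterates n m} {P : NLP n m} {a : Params}

/-- `H(x_k, y_k) + (1/μ^R_k) J_kᵀ J_k`. -/
noncomputable def reducedHess (s : Iterates n m) (P : NLP n m) (k : ℕ) :
    Matrix (Fin n) (Fin n) ℝ :=
  P.lagHess (s.x k) (s.y k) + (1 / s.μR k) • ((P.jac (s.x k))ᵀ * P.jac (s.x k))

lemma what_eq (k : ℕ) : s.what P k = (-(1 / s.μR k)) • fderiv ℝ P.c (s.x k) (s.uhat k) := by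
  rw [what, P.jac_mulVec]
  rfl

namespace IsRun

lemma μR_le_μ (hrun : s.IsRun P a) (k : ℕ) : s.μR k ≤ s.μ k := by
  obtain ⟨μF, h1, h2, -⟩ := hrun.line_search k
  exact h1.trans h2

lemma τ_pos_all (hrun : s.IsRun P a) (k : ℕ) : 0 < s.τ k := by
  induction k with
  | zero => exact hrun.τ_pos
  | succ k ih =>
    by_cases hS : s.STest P a k
    · rw [(hrun.S_update k hS).2.2.2]; exact ih
    by_cases hL : s.LTest P a k
    · rw [(hrun.L_update k hS hL).2.2.2]; exact ih
    by_cases hM : s.MTest P a k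
    · rw [(hrun.M_update k hS hL hM).2.2.2]; linarith
    · rw [(hrun.F_update k hS hL hM).2.2.2]; exact ih

lemma isQPSolution (hrun : s.IsRun P a) (k : ℕ) :
    P.IsQPSolution a.ν (s.yE k) (s.μR k) (s.Hbar k) (s.x k, s.y k) (s.p k, s.q k) :=
  ⟨hrun.qp_feasible k, hrun.qp_min k⟩

lemma uhat_apply_of_notMem (hrun : s.IsRun P a) {k : ℕ} {i : Fin n}
    (hi : i ∉ s.free a k) : s.uhat k i = 0 := by
  obtain ⟨z, -, h | h⟩ := hrun.uhat_eq k <;> simp [h, extendFree, hi]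

/-- If no direction of negative curvature is returned, there is none among the free variables. -/
lemma form_nonneg_of_uhat_eq_zero (hrun : s.IsRun P a) (hf : ContDiff ℝ 2 P.f)
    (hc : ContDiff ℝ 2 P.c) {k : ℕ}
    (h0 : s.uhat k = 0) {d : Fin n → ℝ} (hd : ∀ i ∉ s.free a k, d i = 0) :
    0 ≤ d ⬝ᵥ (s.reducedHess P k *ᵥ d) := by
  obtain ⟨z, hz, h⟩ := hrun.uhat_eq k
  have hz0 : extendFree (s.free a k) z = 0 := by
    rcases h with h | h
    · rw [← h, h0]
    · rw [← neg_eq_zero, ← h, h0]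
  have hu : z ∘ Sum.inl = 0 := by
    ext i
    have := congrArg (fun v : Vec n => v i.1) hz0
    simpa [extendFree] using this
  have := hz.form_nonneg (hrun.μR_pos k) ((P.lagHess_isSymm hf hc _ _).submatrix _) hu
    (fun i => d i)
  rwa [P.submatrix_reducedHess, dotProduct_submatrix_mulVec _ _ hd] at this

/-- The direction returned by the curvature computation has negative curvature. -/
lemma form_neg_of_uhat_ne_zero (hrun : s.IsRun P a) (hf : ContDiff ℝ 2 P.f)
    (hc : ContDiff ℝ 2 P.c) {k : ℕ}
    (h0 : s.uhat k ≠ 0) :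
    (s.uhat k).ofLp ⬝ᵥ (s.reducedHess P k *ᵥ (s.uhat k).ofLp) < 0 := by
  obtain ⟨z, hz, h⟩ := hrun.uhat_eq k
  set e := extendFree (s.free a k) z with he
  have hez : (fun i : {i // i ∈ s.free a k} => e i) = z ∘ Sum.inl := by
    ext i
    simp [he, extendFree]
  have heF : ∀ i ∉ s.free a k, e i = 0 := fun i hi => by simp [he, extendFree, hi]
  have hform : (s.uhat k).ofLp ⬝ᵥ (s.reducedHess P k *ᵥ (s.uhat k).ofLp)
      = e.ofLp ⬝ᵥ (s.reducedHess P k *ᵥ e.ofLp) := by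
    rcases h with h | h
    · rw [h]
    · rw [h, WithLp.ofLp_neg, mulVec_neg, neg_dotProduct_neg]
  have hu : z ∘ Sum.inl ≠ 0 := by
    intro hu
    have he0 : e = 0 := by
      ext i
      by_cases hi : i ∈ s.free a k
      · exact (congrFun (hez.trans hu) ⟨i, hi⟩ : _)
      · exact heF i hi
    rcases h with h | h <;> simp [h, he0] at h0
  have := hz.form_neg (hrun.μR_pos k) ((P.lagHess_isSymm hf hc _ _).submatrix _) hu
  rw [← hez, P.submatrix_reducedHess, dotProduct_submatrix_mulVec _ _ heF] at this
  rw [hform]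
  exact this

lemma exists_scaling (hrun : s.IsRun P a) (k : ℕ) :
    ∃ b : ℝ, s.u k = b • s.uhat k ∧ s.w k = b • s.what P k := by
  rcases hrun.scaling k with ⟨-, hu, hw⟩ | ⟨-, b, -, hu, hw⟩
  · exact ⟨0, by rw [hu, zero_smul], by rw [hw, zero_smul]⟩
  · exact ⟨b, hu, hw⟩

lemma w_eq (hrun : s.IsRun P a) (k : ℕ) :
    s.w k = (-(1 / s.μR k)) • fderiv ℝ P.c (s.x k) (s.u k) := by
  obtain ⟨b, hu, hw⟩ := hrun.exists_scaling k
  rw [hu, hw, what_eq, map_smul, smul_comm]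

/-- The curvature ratio is invariant under scaling, and both sides vanish when `û = 0`. -/
lemma u_form (hrun : s.IsRun P a) (k : ℕ) :
    (s.u k).ofLp ⬝ᵥ (s.reducedHess P k *ᵥ (s.u k).ofLp)
    = s.curvRatio P k * ‖s.u k‖ ^ 2 := by
  obtain ⟨b, hu, -⟩ := hrun.exists_scaling k
  by_cases h0 : s.uhat k = 0
  · simp [hu, h0]
  · have hn : ‖s.uhat k‖ ≠ 0 := norm_ne_zero_iff.2 h0
    have hr : s.curvRatio P k
        = (s.uhat k).ofLp ⬝ᵥ (s.reducedHess P k *ᵥ (s.uhat k).ofLp) / ‖s.uhat k‖ ^ 2 := rfl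
    rw [hr, hu, norm_smul, mul_pow, Real.norm_eq_abs, sq_abs, WithLp.ofLp_smul, mulVec_smul,
      dotProduct_smul, smul_dotProduct, smul_eq_mul, smul_eq_mul]
    field_simp

lemma curv_le (hrun : s.IsRun P a) (hf : ContDiff ℝ 2 P.f) (hc : ContDiff ℝ 2 P.c)
    {k : ℕ} {CH : ℝ}
    (hCH : ‖fderiv ℝ (fderiv ℝ P.c) (s.x k)‖ ≤ CH) :
    s.curv P a k ≤ (s.curvRatio P k + (1 + a.ν) / s.μR k * CH *
      ‖P.c (s.x k) + s.μR k • (s.y k - s.yE k)‖) * ‖s.u k‖ ^ 2 := by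
  have hμ := hrun.μR_pos k
  have hν := a.ν_pos
  have h1 : s.curv P a k = (s.u k).ofLp ⬝ᵥ (s.reducedHess P k *ᵥ (s.u k).ofLp)
      + (1 + a.ν) / s.μR k * inner ℝ (P.c (s.x k) + s.μR k • (s.y k - s.yE k))
        (fderiv ℝ (fderiv ℝ P.c) (s.x k) (s.u k) (s.u k)) := by
    rw [curv, hrun.w_eq k]
    exact P.meritCurv_eq_reducedHess hf hc a.ν (s.yE k) hμ (s.v k) (s.u k)
  set g := P.c (s.x k) + s.μR k • (s.y k - s.yE k) with hg
  have h2 : inner ℝ g (fderiv ℝ (fderiv ℝ P.c) (s.x k) (s.u k) (s.u k))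
      ≤ ‖g‖ * (CH * ‖s.u k‖ * ‖s.u k‖) := by
    refine (real_inner_le_norm _ _).trans (mul_le_mul_of_nonneg_left ?_ (norm_nonneg _))
    refine (ContinuousLinearMap.le_opNorm₂ _ _ _).trans ?_
    gcongr
  rw [h1, hrun.u_form k]
  have h3 := mul_le_mul_of_nonneg_left h2 (by positivity : 0 ≤ (1 + a.ν) / s.μR k)
  linarith

/-- A nonzero curvature direction can be scaled up to a fixed length when the QP step is small. -/
lemma le_norm_u (hrun : s.IsRun P a) {k : ℕ} (h0 : s.uhat k ≠ 0)
    (hp : ‖s.p k‖ ≤ min (s.μR k) a.epsA / 2) :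
    min a.uMax (min (s.μR k) a.epsA / 2) ≤ ‖s.u k‖ := by
  set ξ := min (s.μR k) a.epsA with hξ
  set r := min a.uMax (ξ / 2) with hr
  have hξ0 : 0 < ξ := lt_min (hrun.μR_pos k) a.epsA_pos
  have hr0 : 0 < r := lt_min a.uMax_pos (by linarith)
  have hn : 0 < ‖s.uhat k‖ := norm_pos_iff.2 h0
  rcases hrun.scaling k with ⟨h, -⟩ | ⟨-, b, hb, hu, -⟩
  · exact absurd h h0
  -- Scaling to length `r` is admissible: free variables exceed `ξ`, of which the QP step and the
  -- curvature step use at most half each; the others are not moved by `û`.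
  have hmem : r / ‖s.uhat k‖ ∈ {t : ℝ | (∀ i, 0 ≤ s.x k i + s.p k i + t * s.uhat k i) ∧
        ‖t • s.uhat k‖ ≤ max a.uMax (2 * ‖s.p k‖)} := by
    constructor
    · intro i
      by_cases hi : i ∈ s.free a k
      · have hx : ξ < s.x k i := by
          refine lt_of_le_of_lt ?_ (Finset.mem_filter.1 hi).2
          exact min_le_min_right _ (hrun.μR_le_μ k)
        have h1 : -(ξ / 2) ≤ s.p k i :=
          (neg_le_neg hp).trans (neg_le_of_abs_le (abs_apply_le_norm _ i))
        have h2 : |r / ‖s.uhat k‖ * s.uhat k i| ≤ r := by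
          rw [abs_mul, abs_of_pos (div_pos hr0 hn), div_mul_eq_mul_div, div_le_iff₀ hn]
          exact mul_le_mul_of_nonneg_left (abs_apply_le_norm _ i) hr0.le
        have h3 := neg_le_of_abs_le h2
        have h4 : r ≤ ξ / 2 := min_le_right _ _
        linarith
      · rw [hrun.uhat_apply_of_notMem hi, mul_zero, add_zero]
        exact hrun.qp_feasible k i
    · rw [norm_smul, Real.norm_of_nonneg (div_pos hr0 hn).le, div_mul_cancel₀ _ hn.ne']
      exact (min_le_left _ _).trans (le_max_left _ _)
  have hb' := hb.2 hmem
  have hb0 : 0 ≤ b := (div_pos hr0 hn).le.trans hb'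
  rw [hu, norm_smul, Real.norm_of_nonneg hb0]
  exact (div_le_iff₀ hn).1 hb'

end IsRun

end Iterates

/-! ### Uniform estimates and the M-test. -/

namespace Iterates

variable {n m : ℕ} {s : Iterates n m} {P : NLP n m} {a : Params}

/-- Uniform estimates for the iterations with a fixed regularization parameter: the optimality
conditions of the merit function are controlled by the QP step, the QP step gives sufficient
descent, and the curvature of the merit function agrees with that of `H + (1/μ) JᵀJ` up to a
multiple of the QP step. -/
lemma exists_uniform_bounds (hrun : s.IsRun P a) (hf : ContDiff ℝ 2 P.f) (hc : ContDiff ℝ 2 P.c)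
    (hH : s.HbarAssumption P) {X : Set (Vec n)} (hX : IsCompact X) (hxX : ∀ k, s.x k ∈ X)
    {khat : ℕ} {muR : ℝ} (hmuR : 0 < muR) (hfix : ∀ k, khat ≤ k → s.μR k = muR) :
    ∃ C : ℝ, 0 < C ∧ ∃ l : ℝ, 0 < l ∧ ∀ k, khat ≤ k →
      ‖P.meritGradY a.ν (s.yE k) muR (s.x k) (s.y k)‖ ≤ C * pairNorm (s.p k) (s.q k) ∧
      ‖vmin (s.x k) (P.meritGradX a.ν (s.yE k) muR (s.x k) (s.y k))‖
        ≤ C * pairNorm (s.p k) (s.q k) ∧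
      s.slope P a k ≤ -(l * pairNorm (s.p k) (s.q k) ^ 2) ∧
      s.curv P a k
        ≤ (s.curvRatio P k + C * pairNorm (s.p k) (s.q k)) * ‖s.u k‖ ^ 2 := by
  obtain ⟨hsymm, ⟨CB, hCB⟩, l, hl, hlB⟩ := hH
  have hc1 : ContDiff ℝ 1 (fderiv ℝ P.c) := hc.fderiv_right (by norm_num)
  obtain ⟨CJ, hCJ⟩ := hX.exists_bound_of_continuousOn hc1.continuous.continuousOn
  obtain ⟨CH, hCH⟩ := hX.exists_bound_of_continuousOn
    (hc1.continuous_fderiv (by norm_num)).continuousOn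
  have hν := a.ν_pos
  obtain ⟨C, hC, hopt⟩ := NLP.exists_optimality_bound hf hc a.ν_pos hmuR CJ CB
  obtain ⟨c, hc0, hdesc⟩ := NLP.exists_descent_bound (P := P) a.ν_pos hmuR CJ hl
  have hCC : 0 ≤ (1 + a.ν) / muR * |CH| * C := by positivity
  refine ⟨C + (1 + a.ν) / muR * |CH| * C, by linarith, c, hc0, fun k hk => ?_⟩
  have hμk := hfix k hk
  have hqp := hrun.isQPSolution k
  have hlk := hlB k (s.p k)
  rw [hμk] at hqp hlk
  obtain ⟨h1, h2, h3⟩ := hopt _ _ _ _ _ _ (hsymm k) (hCB k) (hCJ _ (hxX k)) hqp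
  have h4 := hdesc _ _ _ _ _ _ (hsymm k) (hrun.x_nonneg k) (hCJ _ (hxX k)) hlk hqp
  have h5 := hrun.curv_le hf hc ((hCH _ (hxX k)).trans (le_abs_self _))
  set N := pairNorm (s.p k) (s.q k) with hN
  have hN0 : 0 ≤ N := pairNorm_nonneg _ _
  have hCN : 0 ≤ (1 + a.ν) / muR * |CH| * C * N := mul_nonneg hCC hN0
  have hCN' : 0 ≤ C * N := by positivity
  refine ⟨by linarith, by linarith, ?_, ?_⟩
  · rw [slope, hμk]
    exact h4
  · refine h5.trans (mul_le_mul_of_nonneg_right ?_ (sq_nonneg _))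
    rw [hμk]
    have := mul_le_mul_of_nonneg_left h1 (by positivity : 0 ≤ (1 + a.ν) / muR * |CH|)
    linarith

/-- A null step repeats the iterate and leaves the penalty parameter unchanged. -/
lemma IsRun.succ_eq_of_null_step (hrun : s.IsRun P a) {k : ℕ} (hp : s.p k = 0) (hq : s.q k = 0)
    (hu : s.u k = 0) (hw : s.w k = 0) :
    s.x (k + 1) = s.x k ∧ s.y (k + 1) = s.y k ∧ s.μ (k + 1) = s.μ k := by
  have hx : s.x (k + 1) = s.x k := by rw [hrun.x_succ, hu, hp]; simp
  have hy : s.y (k + 1) = s.y k := by rw [hrun.y_succ, hw, hq]; simp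
  refine ⟨hx, hy, hrun.μ_keep k ?_⟩
  have hv : s.v (k + 1) = s.v k := by rw [v, v, hx, hy]
  have hcurv : s.curv P a k = 0 := by
    rw [curv, hu, hw, NLP.meritCurv, show ((0 : Vec n), (0 : Vec m)) = 0 from rfl, map_zero]
  have hslope : s.slope P a k = 0 := by
    rw [slope, hp, hq, NLP.meritSlope, show ((0 : Vec n), (0 : Vec m)) = 0 from rfl, map_zero]
  have hN : s.Nk P a k = 0 := by
    rw [Nk, hslope, pairNorm_sq, hp, hq]
    simp
  rw [hv, hcurv, hN]
  simp

/-- If the iterate does not pass the M-test although its optimality residuals are small, then its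
curvature ratio is below `-τ`. -/
lemma curvRatio_lt_of_not_MTest {k : ℕ} (hM : ¬ s.MTest P a k) (hyE : s.yE (k + 1) = s.yE k)
    {muR : ℝ} (hμ : s.μR k = muR)
    (hY : ‖P.meritGradY a.ν (s.yE (k + 1)) muR (s.x (k + 1)) (s.y (k + 1))‖ ≤ s.τ k)
    (hX : ‖vmin (s.x (k + 1))
      (P.meritGradX a.ν (s.yE (k + 1)) muR (s.x (k + 1)) (s.y (k + 1)))‖ ≤ s.τ k) :
    s.curvRatio P (k + 1) < -s.τ k := by
  by_contra h
  rw [hyE] at hY hX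
  exact hM ⟨by rw [hμ]; exact hY, by rw [hμ]; exact hX, not_lt.1 h⟩

lemma uhat_ne_zero_of_curvRatio_neg {k : ℕ} (h : s.curvRatio P k < 0) : s.uhat k ≠ 0 := by
  intro h0
  simp [curvRatio, h0] at h

end Iterates

end PDSQP

/-! ### The main theorem. -/

open PDSQP PDSQP.Iterates

theorem mainTheorem2 {n m : ℕ} (P : PDSQP.NLP n m) (a : PDSQP.Params)
    (s : PDSQP.Iterates n m)
    (hf : ContDiff ℝ 2 P.f) (hc : ContDiff ℝ 2 P.c)
    (hrun : s.IsRun P a)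
    (hH : s.HbarAssumption P)
    (hx : ∃ X : Set (PDSQP.Vec n), IsCompact X ∧ ∀ k, s.x k ∈ X)
    (khat : ℕ) (muR : ℝ) (hmuR : 0 < muR)
    (hfix : ∀ k, khat ≤ k → s.μR k = muR)
    (hF : ∀ k, khat ≤ k → s.IsFIterate P a k) :
    (∃ δ : ℝ, 0 < δ ∧ ∀ k, khat ≤ k → δ ≤ PDSQP.pairNorm (s.p k) (s.q k) + ‖s.u k‖) ∧
    (∃ ε : ℝ, 0 < ε ∧ ∀ k, khat ≤ k →
      s.slope P a k ≤ -ε ∨ s.curv P a k ≤ -ε) := by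
  obtain ⟨X, hX, hxX⟩ := hx
  obtain ⟨C, hC, l, hl, hbound⟩ := exists_uniform_bounds hrun hf hc hH hX hxX hmuR hfix
  have htests : ∀ k, khat ≤ k → ¬ s.STest P a k ∧ ¬ s.LTest P a k ∧ ¬ s.MTest P a k :=
    fun k hk => hF (k + 1) (by omega) k rfl
  have hupd : ∀ k, khat ≤ k → s.yE (k + 1) = s.yE k ∧ s.τ (k + 1) = s.τ k := fun k hk =>
    (hrun.F_update k (htests k hk).1 (htests k hk).2.1 (htests k hk).2.2).2.2
  set τ := s.τ khat with hτ
  have hτ0 : 0 < τ := hrun.τ_pos_all khat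
  have hτk : ∀ k, khat ≤ k → s.τ k = τ := fun k hk => by
    induction k, hk using Nat.le_induction with
    | base => rfl
    | succ k hk ih => rw [(hupd k hk).2, ih]
  set ξ := min muR a.epsA with hξ
  have hξ0 : 0 < ξ := lt_min hmuR a.epsA_pos
  set r := min a.uMax (ξ / 2) with hr
  have hr0 : 0 < r := lt_min a.uMax_pos (by linarith)
  have hu_ge : ∀ k, khat ≤ k → s.uhat k ≠ 0 → pairNorm (s.p k) (s.q k) ≤ ξ / 2 → r ≤ ‖s.u k‖ := by
    intro k hk h0 hN
    have := hrun.le_norm_u h0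
    rw [hfix k hk] at this
    exact this ((norm_fst_le_pairNorm _ _).trans hN)
  -- The first bound leaves room for the curvature direction; the second keeps the residuals and the
  -- curvature error below `τ / 2`.
  set δ := min (ξ / 2) (τ / (2 * C)) with hδ
  have hδ0 : 0 < δ := lt_min (by linarith) (by positivity)
  -- The inequality is strict since the test of `v_k` uses the parameters of iteration `k - 1`,
  -- which must already be frozen.
  have htail : ∀ k, khat < k → δ ≤ pairNorm (s.p k) (s.q k) ∨
      (r ≤ ‖s.u k‖ ∧ s.curv P a k ≤ -(τ / 2 * r ^ 2)) := by
    intro k hk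
    obtain ⟨j, rfl⟩ : ∃ j, k = j + 1 := ⟨k - 1, by omega⟩
    have hj : khat ≤ j := by omega
    refine or_iff_not_imp_left.2 fun hN => ?_
    push Not at hN
    set N := pairNorm (s.p (j + 1)) (s.q (j + 1)) with hNdef
    have hCN : C * N ≤ τ / 2 := by
      have : N ≤ τ / (2 * C) := hN.le.trans (min_le_right _ _)
      rw [le_div_iff₀ (by positivity)] at this
      linarith
    obtain ⟨hY, hXg, -, hcurv⟩ := hbound (j + 1) (by omega)
    have hθ := curvRatio_lt_of_not_MTest (htests j hj).2.2 (hupd j hj).1 (hfix j hj)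
      (by rw [hτk j hj]; linarith) (by rw [hτk j hj]; linarith)
    rw [hτk j hj] at hθ
    have hur := hu_ge (j + 1) (by omega) (uhat_ne_zero_of_curvRatio_neg (hθ.trans (by linarith)))
      (hN.le.trans (min_le_left _ _))
    refine ⟨hur, hcurv.trans ?_⟩
    have h1 : s.curvRatio P (j + 1) + C * N ≤ -(τ / 2) := by linarith
    have h2 : r ^ 2 ≤ ‖s.u (j + 1)‖ ^ 2 := pow_le_pow_left₀ hr0.le hur 2
    calc _ ≤ -(τ / 2) * ‖s.u (j + 1)‖ ^ 2 := mul_le_mul_of_nonneg_right h1 (sq_nonneg _)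
      _ ≤ -(τ / 2 * r ^ 2) := by
        have := mul_le_mul_of_nonneg_left h2 (by linarith : 0 ≤ τ / 2)
        linarith
  set N₀ := pairNorm (s.p khat) (s.q khat) with hN₀
  have hfirst : 0 < N₀ ∨ (0 < ‖s.u khat‖ ∧ s.curv P a khat < 0) := by
    refine or_iff_not_imp_left.2 fun hN => ?_
    have hN0 : N₀ = 0 := le_antisymm (not_lt.1 hN) (pairNorm_nonneg _ _)
    have hp : s.p khat = 0 := norm_le_zero_iff.1 ((norm_fst_le_pairNorm _ _).trans hN0.le)
    have hq : s.q khat = 0 := norm_le_zero_iff.1 ((norm_snd_le_pairNorm _ _).trans hN0.le)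
    obtain ⟨hY, hXg, -, hcurv⟩ := hbound khat le_rfl
    rw [← hN₀, hN0, mul_zero] at hY hXg hcurv
    -- With no direction at all the iterate repeats, and the next factorization meets the same
    -- reduced Hessian and free variables.
    by_cases h0 : s.uhat khat = 0
    · exfalso
      obtain ⟨b, hu, hw⟩ := hrun.exists_scaling khat
      have hu0 : s.u khat = 0 := by rw [hu, h0, smul_zero]
      have hw0 : s.w khat = 0 := by rw [hrun.w_eq, hu0, map_zero, smul_zero]
      obtain ⟨hx', hy', hμ'⟩ := hrun.succ_eq_of_null_step hp hq hu0 hw0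
      have hθ := curvRatio_lt_of_not_MTest (htests khat le_rfl).2.2 (hupd khat le_rfl).1
        (hfix khat le_rfl) (by rw [(hupd khat le_rfl).1, hx', hy']; linarith)
        (by rw [(hupd khat le_rfl).1, hx', hy']; linarith)
      have hfree : s.free a (khat + 1) = s.free a khat := by rw [free, free, hx', hμ']
      have hred : s.reducedHess P (khat + 1) = s.reducedHess P khat := by
        rw [reducedHess, reducedHess, hx', hy', hfix khat le_rfl, hfix (khat + 1) (by omega)]
      have hform := hrun.form_nonneg_of_uhat_eq_zero hf hc h0 (d := (s.uhat (khat + 1)).ofLp)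
        fun i hi => hrun.uhat_apply_of_notMem (by rw [hfree]; exact hi)
      rw [← hred] at hform
      -- No case distinction on the new direction is needed, since a quotient by zero is zero.
      have hθ0 : 0 ≤ s.curvRatio P (khat + 1) := div_nonneg hform (sq_nonneg _)
      linarith
    · have hur := hr0.trans_le (hu_ge khat le_rfl h0 (hN0.le.trans (by linarith)))
      have hθ : s.curvRatio P khat < 0 :=
        div_neg_of_neg_of_pos (hrun.form_neg_of_uhat_ne_zero hf hc h0)
          (by have := norm_pos_iff.2 h0; positivity)
      refine ⟨hur, hcurv.trans_lt ?_⟩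
      rw [add_zero]
      exact mul_neg_of_neg_of_pos hθ (by positivity)
  constructor
  -- The last term covers the single index `khat`.
  · refine ⟨min (min δ r) (N₀ + ‖s.u khat‖), lt_min (lt_min hδ0 hr0) ?_, fun k hk => ?_⟩
    · rcases hfirst with h | h
      · exact add_pos_of_pos_of_nonneg h (norm_nonneg _)
      · exact add_pos_of_nonneg_of_pos (pairNorm_nonneg _ _) h.1
    · rcases hk.eq_or_lt with rfl | hk
      · exact min_le_right _ _
      · refine (min_le_left _ _).trans ?_
        rcases htail k hk with h | h
        · exact (min_le_left _ _).trans (h.trans (le_add_of_nonneg_right (norm_nonneg _)))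
        · exact (min_le_right _ _).trans
            (h.1.trans (le_add_of_nonneg_left (pairNorm_nonneg _ _)))
  · obtain ⟨ε₀, hε₀, hfirst'⟩ : ∃ ε : ℝ, 0 < ε ∧
        (s.slope P a khat ≤ -ε ∨ s.curv P a khat ≤ -ε) := by
      rcases hfirst with h | h
      · exact ⟨l * N₀ ^ 2, by positivity, Or.inl (hbound khat le_rfl).2.2.1⟩
      · exact ⟨-s.curv P a khat, by linarith [h.2], Or.inr (by linarith)⟩
    refine ⟨min ε₀ (min (l * δ ^ 2) (τ / 2 * r ^ 2)),
      lt_min hε₀ (lt_min (by positivity) (by positivity)), fun k hk => ?_⟩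
    rcases hk.eq_or_lt with rfl | hk
    · exact hfirst'.imp (fun h => h.trans (neg_le_neg (min_le_left _ _)))
        (fun h => h.trans (neg_le_neg (min_le_left _ _)))
    · rcases htail k hk with h | h
      · refine Or.inl ((hbound k hk.le).2.2.1.trans (neg_le_neg ?_))
        refine ((min_le_right _ _).trans (min_le_left _ _)).trans ?_
        exact mul_le_mul_of_nonneg_left (pow_le_pow_left₀ hδ0.le h 2) hl.le
      · exact Or.inr (h.2.trans (neg_le_neg ((min_le_right _ _).trans (min_le_right _ _))))
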